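/- Let $k$ be a field of characteristic zero, let $n \ge 0$, and let $A = A_n(k)$ be the $n$-th Weyl algebra, i.e. the $k$-algebra generated by $x_1,\dots,x_n,\partial_1,\dots,\partial_n$ with relations $[x_i,x_j]=0$, $[\partial_i,\partial_j]=0$, $[\partial_i,x_j]=\delta_{ij}$. Let $f: A \to A$ be a $k$-algebra endomorphism. The graph $A^f$ is the $A$-bimodule with underlying vector space $A$, the usual left multiplication, and right action twisted by $f$, so that $a\cdot m\cdot s = a\,m\,f(s)$. The dual graph ${}^f A$ is the $A$-bimodule with underlying vector space $A$, the usual right multiplication, and left action twisted by $f$, so that $a\cdot m\cdot s = f(a)\,m\,s$. Then: 1. $A^f$ and ${}^f A$ are holonomic bimodules over $A$; 2. $A^f$ and ${}^f A$ are simple bimodules over $A$, i.e. each is nonzero and has no subbimodules other than $0$ and itself. Here a bimodule over $A_n(k)$ is called holonomic if it is holonomic as a left $A_{2n}(k)$-module through the isomorphism $A_{2n}(k) \cong A_n(k)\otimes_k A_n(k)^{\mathrm{op}}$ given by $x_i \mapsto x_i\otimes 1$, $x_{n+i}\mapsto 1\otimes x_i$, $\partial_i\mapsto \partial_i\otimes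 1$, $\partial_{n+i}\mapsto -1\otimes\partial_i$ for $1\le i\le n$. A left $A_N(k)$-module $M$ is called holonomic if it is finitely generated and either $M=0$ or $\dim M = N$. To define $\dim M$, let $B_m\subset A_N(k)$ be the $k$-span of the monomials $x^\alpha\partial^\beta$ with $|\alpha|+|\beta|\le m$. Let $\Gamma_0\subset\Gamma_1\subset\cdots$ be a good filtration of $M$, i.e. an increasing sequence of finite dimensional subspaces with union $M$ and $B_i\Gamma_j\subset\Gamma_{i+j}$ for all $i, j$, such that $\bigoplus_i \Gamma_i/\Gamma_{i-1}$ (with $\Gamma_{-1}=0$) is finitely generated over the ring $\bigoplus_i B_i/B_{i-1}$ (with $B_{-1}=0$). Then $\dim M$ is the degree of the polynomial $p\in\mathbb{Q}[t]$ with $\dim_k\Gamma_i = p(i)$ for all sufficiently large $i$; it does not depend on the choice of $\Gamma$. -/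

import Mathlib

open scoped TensorProduct DirectSum

noncomputable section

/-! ### The Weyl algebra -/

/-- The defining relations of the `n`-th Weyl algebra on the free algebra with generators
`x i = Sum.inl i` and `∂ i = Sum.inr i`. -/
inductive WeylRel (k : Type*) [Field k] (n : ℕ) :
    FreeAlgebra k (Fin n ⊕ Fin n) → FreeAlgebra k (Fin n ⊕ Fin n) → Prop
  | xx (i j : Fin n) : WeylRel k n
      (FreeAlgebra.ι k (Sum.inl i) * FreeAlgebra.ι k (Sum.inl j)
        - FreeAlgebra.ι k (Sum.inl j) * FreeAlgebra.ι k (Sum.inl i)) 0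
  | dd (i j : Fin n) : WeylRel k n
      (FreeAlgebra.ι k (Sum.inr i) * FreeAlgebra.ι k (Sum.inr j)
        - FreeAlgebra.ι k (Sum.inr j) * FreeAlgebra.ι k (Sum.inr i)) 0
  | dx (i j : Fin n) : WeylRel k n
      (FreeAlgebra.ι k (Sum.inr i) * FreeAlgebra.ι k (Sum.inl j)
        - FreeAlgebra.ι k (Sum.inl j) * FreeAlgebra.ι k (Sum.inr i)) (if i = j then 1 else 0)

/-- The `n`-th Weyl algebra `A_n(k)`. -/
def WeylAlgebra (k : Type*) [Field k] (n : ℕ) : Type _ := RingQuot (WeylRel k n)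

namespace WeylAlgebra

instance instRing (k : Type*) [Field k] (n : ℕ) : Ring (WeylAlgebra k n) :=
  inferInstanceAs (Ring (RingQuot (WeylRel k n)))

instance instAlgebra (k : Type*) [Field k] (n : ℕ) : Algebra k (WeylAlgebra k n) :=
  inferInstanceAs (Algebra k (RingQuot (WeylRel k n)))

/-- The quotient map from the free algebra. -/
def mk (k : Type*) [Field k] (n : ℕ) :
    FreeAlgebra k (Fin n ⊕ Fin n) →ₐ[k] WeylAlgebra k n :=
  RingQuot.mkAlgHom k (WeylRel k n)

/-- The generator `x_i`. -/
def x (k : Type*) [Field k] {n : ℕ} (i : Fin n) : WeylAlgebra k n :=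
  mk k n (FreeAlgebra.ι k (Sum.inl i))

/-- The generator `∂_i`. -/
def d (k : Type*) [Field k] {n : ℕ} (i : Fin n) : WeylAlgebra k n :=
  mk k n (FreeAlgebra.ι k (Sum.inr i))

section Basic

variable {k : Type*} [Field k] {n : ℕ}

theorem x_comm (i j : Fin n) : x k i * x k j = x k j * x k i := by
  have := RingQuot.mkAlgHom_rel k (WeylRel.xx (k := k) i j)
  rw [map_sub, map_mul, map_mul, map_zero] at this
  exact sub_eq_zero.1 this

theorem d_comm (i j : Fin n) : d k i * d k j = d k j * d k i := by
  have := RingQuot.mkAlgHom_rel k (WeylRel.dd (k := k) i j)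
  rw [map_sub, map_mul, map_mul, map_zero] at this
  exact sub_eq_zero.1 this

theorem d_x (i j : Fin n) :
    d k i * x k j - x k j * d k i = if i = j then 1 else 0 := by
  have := RingQuot.mkAlgHom_rel k (WeylRel.dx (k := k) i j)
  rw [map_sub, map_mul, map_mul] at this
  refine this.trans ?_
  split_ifs
  · exact map_one _
  · exact map_zero _

/-- The universal property of the Weyl algebra. -/
def lift {B : Type*} [Ring B] [Algebra k B] (gx gd : Fin n → B)
    (hxx : ∀ i j, gx i * gx j = gx j * gx i) (hdd : ∀ i j, gd i * gd j = gd j * gd i)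
    (hdx : ∀ i j, gd i * gx j - gx j * gd i = if i = j then 1 else 0) :
    WeylAlgebra k n →ₐ[k] B :=
  RingQuot.liftAlgHom k ⟨FreeAlgebra.lift k (Sum.elim gx gd), by
    intro a b h
    cases h with
    | xx i j => simp [hxx i j]
    | dd i j => simp [hdd i j]
    | dx i j =>
      simp only [map_sub, map_mul, FreeAlgebra.lift_ι_apply, Sum.elim_inl, Sum.elim_inr, hdx i j]
      split_ifs <;> simp⟩

theorem lift_x {B : Type*} [Ring B] [Algebra k B] (gx gd : Fin n → B) (hxx hdd hdx)
    (i : Fin n) : lift (k := k) gx gd hxx hdd hdx (x k i) = gx i := by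
  unfold lift x mk
  erw [RingQuot.liftAlgHom_mkAlgHom_apply]
  simp

theorem lift_d {B : Type*} [Ring B] [Algebra k B] (gx gd : Fin n → B) (hxx hdd hdx)
    (i : Fin n) : lift (k := k) gx gd hxx hdd hdx (d k i) = gd i := by
  unfold lift d mk
  erw [RingQuot.liftAlgHom_mkAlgHom_apply]
  simp

theorem hom_ext {B : Type*} [Ring B] [Algebra k B] {f g : WeylAlgebra k n →ₐ[k] B}
    (hx : ∀ i, f (x k i) = g (x k i)) (hd : ∀ i, f (d k i) = g (d k i)) : f = g := by
  have h : f.comp (mk k n) = g.comp (mk k n) := by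
    apply FreeAlgebra.hom_ext
    funext s
    cases s with
    | inl i => exact hx i
    | inr i => exact hd i
  exact RingQuot.ringQuot_ext' (S := k) (s := WeylRel k n) (B := B) f g h

theorem adjoin_eq_top :
    Algebra.adjoin k (Set.range (x k (n := n)) ∪ Set.range (d k (n := n))) = ⊤ := by
  set S := Algebra.adjoin k (Set.range (x k (n := n)) ∪ Set.range (d k (n := n))) with hS
  have mx : ∀ i, x k i ∈ S := fun i => Algebra.subset_adjoin (Or.inl ⟨i, rfl⟩)
  have md : ∀ i, d k i ∈ S := fun i => Algebra.subset_adjoin (Or.inr ⟨i, rfl⟩)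
  let φ : WeylAlgebra k n →ₐ[k] S := lift (fun i => ⟨x k i, mx i⟩) (fun i => ⟨d k i, md i⟩)
    (fun i j => Subtype.ext (x_comm i j)) (fun i j => Subtype.ext (d_comm i j))
    (fun i j => by
      apply Subtype.ext
      have := d_x (k := k) i j
      simp only [Subalgebra.coe_sub, Subalgebra.coe_mul, this]
      split_ifs <;> simp)
  have h : S.val.comp φ = AlgHom.id k _ := by
    apply hom_ext
    · intro i; simp [φ, lift_x]
    · intro i; simp [φ, lift_d]
  rw [eq_top_iff]
  intro a _
  have := DFunLike.congr_fun h a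
  simp only [AlgHom.comp_apply, AlgHom.id_apply] at this
  rw [← this]
  exact (φ a).2

/-- If the images of the generators commute, all elements of the images commute. -/
theorem commute_of_gen {m : ℕ} {B : Type*} [Ring B] [Algebra k B]
    (f : WeylAlgebra k n →ₐ[k] B) (g : WeylAlgebra k m →ₐ[k] B)
    (hxx : ∀ i j, Commute (f (x k i)) (g (x k j))) (hxd : ∀ i j, Commute (f (x k i)) (g (d k j)))
    (hdx : ∀ i j, Commute (f (d k i)) (g (x k j))) (hdd : ∀ i j, Commute (f (d k i)) (g (d k j)))
    (a : WeylAlgebra k n) (b : WeylAlgebra k m) : Commute (f a) (g b) := by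
  have key : ∀ c : B, (∀ j, Commute c (g (x k j))) → (∀ j, Commute c (g (d k j))) →
      ∀ b, Commute c (g b) := by
    intro c h1 h2 b
    have hb : b ∈ Algebra.adjoin k (Set.range (x k (n := m)) ∪ Set.range (d k (n := m))) := by
      rw [adjoin_eq_top]; trivial
    induction hb using Algebra.adjoin_induction with
    | mem y hy =>
      rcases hy with ⟨j, rfl⟩ | ⟨j, rfl⟩
      · exact h1 j
      · exact h2 j
    | algebraMap r => rw [AlgHom.commutes]; exact (Algebra.commutes r c).symm
    | add _ _ _ _ h h' => rw [map_add]; exact h.add_right h'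
    | mul _ _ _ _ h h' => rw [map_mul]; exact h.mul_right h'
  have ha : a ∈ Algebra.adjoin k (Set.range (x k (n := n)) ∪ Set.range (d k (n := n))) := by
    rw [adjoin_eq_top]; trivial
  induction ha using Algebra.adjoin_induction with
  | mem y hy =>
    rcases hy with ⟨j, rfl⟩ | ⟨j, rfl⟩
    · exact key _ (hxx j) (hxd j) b
    · exact key _ (hdx j) (hdd j) b
  | algebraMap r => rw [AlgHom.commutes]; exact Algebra.commutes r (g b)
  | add _ _ _ _ h h' => rw [map_add]; exact h.add_left h'
  | mul _ _ _ _ h h' => rw [map_mul]; exact h.mul_left h'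

end Basic

/-! ### The isomorphism `A_n(k) ⊗ A_n(k)ᵒᵖ ≅ A_{2n}(k)` -/

section Double

variable (k : Type*) [Field k] (n : ℕ)

/-- The inclusion `A_n(k) → A_{2n}(k)` with `x_i ↦ x_i`, `∂_i ↦ ∂_i`. -/
def inclLeft : WeylAlgebra k n →ₐ[k] WeylAlgebra k (n + n) :=
  lift (fun i => x k (Fin.castAdd n i)) (fun i => d k (Fin.castAdd n i))
    (fun _ _ => x_comm _ _) (fun _ _ => d_comm _ _) (fun i j => by simp [d_x])

/-- The inclusion `A_n(k) → A_{2n}(k)` with `x_i ↦ x_{n+i}`, `∂_i ↦ ∂_{n+i}`. -/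
def inclRight : WeylAlgebra k n →ₐ[k] WeylAlgebra k (n + n) :=
  lift (fun i => x k (Fin.natAdd n i)) (fun i => d k (Fin.natAdd n i))
    (fun _ _ => x_comm _ _) (fun _ _ => d_comm _ _) (fun i j => by simp [d_x])

/-- The map `A_n(k) ⊗ A_n(k) → A_{2n}(k)` with `x_i ⊗ 1 ↦ x_i`, `1 ⊗ x_i ↦ x_{n+i}`,
`∂_i ⊗ 1 ↦ ∂_i`, `1 ⊗ ∂_i ↦ ∂_{n+i}`. -/
def doubleHom : WeylAlgebra k n ⊗[k] WeylAlgebra k n →ₐ[k] WeylAlgebra k (n + n) :=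
  Algebra.TensorProduct.lift (inclLeft k n) (inclRight k n)
    (commute_of_gen _ _
      (fun i j => by simp only [inclLeft, inclRight, lift_x]; exact x_comm _ _)
      (fun i j => by
        simp only [inclLeft, inclRight, lift_x, lift_d]
        have h := d_x (k := k) (Fin.natAdd n j) (Fin.castAdd n i)
        rw [if_neg (by simp [Fin.ext_iff]; omega)] at h
        exact (sub_eq_zero.1 h).symm)
      (fun i j => by
        simp only [inclLeft, inclRight, lift_x, lift_d]
        have h := d_x (k := k) (Fin.castAdd n i) (Fin.natAdd n j)
        rw [if_neg (by simp [Fin.ext_iff]; omega)] at h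
        exact sub_eq_zero.1 h)
      (fun i j => by simp only [inclLeft, inclRight, lift_d]; exact d_comm _ _))

/-- The inverse of `doubleHom`. -/
def doubleInv : WeylAlgebra k (n + n) →ₐ[k] WeylAlgebra k n ⊗[k] WeylAlgebra k n :=
  lift
    (Fin.addCases (fun i => x k i ⊗ₜ 1) (fun i => 1 ⊗ₜ x k i))
    (Fin.addCases (fun i => d k i ⊗ₜ 1) (fun i => 1 ⊗ₜ d k i))
    (fun i j => by
      cases i using Fin.addCases <;> cases j using Fin.addCases <;>
        simp [-Fin.natAdd_eq_addNat, Algebra.TensorProduct.tmul_mul_tmul, x_comm])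
    (fun i j => by
      cases i using Fin.addCases <;> cases j using Fin.addCases <;>
        simp [-Fin.natAdd_eq_addNat, Algebra.TensorProduct.tmul_mul_tmul, d_comm])
    (fun i j => by
      cases i using Fin.addCases <;> cases j using Fin.addCases
      · simp only [Fin.addCases_left, Algebra.TensorProduct.tmul_mul_tmul, mul_one,
          ← TensorProduct.sub_tmul, d_x, Fin.castAdd_inj]
        split_ifs <;> simp [Algebra.TensorProduct.one_def]
      · rw [if_neg (by simp [Fin.ext_iff]; omega)]
        simp [-Fin.natAdd_eq_addNat, Algebra.TensorProduct.tmul_mul_tmul]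
      · rw [if_neg (by simp [Fin.ext_iff]; omega)]
        simp [-Fin.natAdd_eq_addNat, Algebra.TensorProduct.tmul_mul_tmul]
      · simp only [Fin.addCases_right, Algebra.TensorProduct.tmul_mul_tmul, mul_one,
          ← TensorProduct.tmul_sub, d_x, Fin.natAdd_inj]
        split_ifs <;> simp [Algebra.TensorProduct.one_def])

/-- The isomorphism `A_n(k) ⊗ A_n(k) ≅ A_{2n}(k)`. -/
def doubleEquiv : WeylAlgebra k n ⊗[k] WeylAlgebra k n ≃ₐ[k] WeylAlgebra k (n + n) :=
  AlgEquiv.ofAlgHom (doubleHom k n) (doubleInv k n)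
    (by
      apply hom_ext <;> intro i <;> cases i using Fin.addCases <;>
        simp [-Fin.natAdd_eq_addNat, doubleHom, doubleInv, lift_x, lift_d, inclLeft, inclRight])
    (by
      apply Algebra.TensorProduct.ext <;> apply hom_ext <;> intro i <;>
        simp [-Fin.natAdd_eq_addNat, doubleHom, doubleInv, lift_x, lift_d, inclLeft, inclRight])

/-- The map `τ : A_n(k) → A_n(k)ᵒᵖ` with `x_i ↦ x_i`, `∂_i ↦ -∂_i`. -/
def transposeHom : WeylAlgebra k n →ₐ[k] (WeylAlgebra k n)ᵐᵒᵖ :=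
  lift (fun i => MulOpposite.op (x k i)) (fun i => MulOpposite.op (-d k i))
    (fun i j => by rw [← MulOpposite.op_mul, ← MulOpposite.op_mul, x_comm])
    (fun i j => by rw [← MulOpposite.op_mul, ← MulOpposite.op_mul, neg_mul_neg, neg_mul_neg, d_comm])
    (fun i j => by
      rw [← MulOpposite.op_mul, ← MulOpposite.op_mul, ← MulOpposite.op_sub]
      have : x k j * -d k i - -d k i * x k j = if i = j then 1 else 0 := by
        rw [← d_x]; noncomm_ring
      rw [this]
      split_ifs <;> rfl)

/-- The inverse of `τ`. -/
def transposeInv : (WeylAlgebra k n)ᵐᵒᵖ →ₐ[k] WeylAlgebra k n :=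
  (AlgEquiv.opOp k (WeylAlgebra k n)).symm.toAlgHom.comp (AlgHom.op (transposeHom k n))

/-- The isomorphism `τ : A_n(k) ≅ A_n(k)ᵒᵖ`. -/
def transpose : WeylAlgebra k n ≃ₐ[k] (WeylAlgebra k n)ᵐᵒᵖ :=
  have h : (transposeInv k n).comp (transposeHom k n) = AlgHom.id k _ := by
    apply hom_ext <;> intro i <;> simp [transposeInv, transposeHom, lift_x, lift_d]
  AlgEquiv.ofAlgHom (transposeHom k n) (transposeInv k n)
    (by
      ext a
      have := DFunLike.congr_fun h (MulOpposite.unop a)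
      simpa [transposeInv] using congrArg MulOpposite.op this)
    h

/-- The isomorphism `A_n(k)ᵉ = A_n(k) ⊗ A_n(k)ᵒᵖ ≅ A_{2n}(k)`. -/
def envelopingEquiv :
    WeylAlgebra k n ⊗[k] (WeylAlgebra k n)ᵐᵒᵖ ≃ₐ[k] WeylAlgebra k (n + n) :=
  (Algebra.TensorProduct.congr AlgEquiv.refl (transpose k n).symm).trans (doubleEquiv k n)

end Double

/-! ### The Bernstein filtration -/

section Bernstein

variable (k : Type*) [Field k] {n : ℕ}

/-- `x^α = x_1^{α_1} ⋯ x_n^{α_n}`. -/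
def xPow (α : Fin n → ℕ) : WeylAlgebra k n := (List.ofFn fun i => x k i ^ α i).prod

/-- `∂^β = ∂_1^{β_1} ⋯ ∂_n^{β_n}`. -/
def dPow (β : Fin n → ℕ) : WeylAlgebra k n := (List.ofFn fun i => d k i ^ β i).prod

/-- `B_m`, the span of the monomials `x^α ∂^β` with `|α| + |β| ≤ m`. -/
def bernsteinSpan (n m : ℕ) : Submodule k (WeylAlgebra k n) :=
  Submodule.span k {a | ∃ α β : Fin n → ℕ, (∑ i, α i) + (∑ i, β i) ≤ m ∧ a = xPow k α * dPow k β}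

variable {k}

theorem ofFn_pow_mul {R : Type*} [Monoid R] : ∀ {n : ℕ} (g : Fin n → R)
    (_ : ∀ i j, g i * g j = g j * g i) (i : Fin n) (α : Fin n → ℕ),
    (List.ofFn fun j => g j ^ (α + Pi.single i 1 : Fin n → ℕ) j).prod
      = g i * (List.ofFn fun j => g j ^ α j).prod := by
  intro n
  induction n with
  | zero => intro g _ i; exact i.elim0
  | succ n ih =>
    intro g hg i α
    rw [List.ofFn_succ, List.ofFn_succ, List.prod_cons, List.prod_cons]
    cases i using Fin.cases with
    | zero => simp [pow_succ', mul_assoc]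
    | succ i =>
      have h := ih (fun j => g j.succ) (fun _ _ => hg _ _) i (fun j => α j.succ)
      have e : (fun j : Fin n => g j.succ ^ (α + Pi.single i.succ 1 : Fin (n + 1) → ℕ) j.succ)
          = fun j => g j.succ ^ ((fun j => α j.succ) + Pi.single i 1 : Fin n → ℕ) j := by
        funext j
        simp [Pi.single_apply]
      rw [e, h, ← mul_assoc, ← mul_assoc]
      have c : Commute (g 0) (g i.succ) := hg _ _
      simp [(c.pow_left (α 0)).eq]

theorem xPow_add_single (i : Fin n) (α : Fin n → ℕ) :
    xPow k (α + Pi.single i 1) = x k i * xPow k α := ofFn_pow_mul _ x_comm i α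

theorem dPow_add_single (i : Fin n) (α : Fin n → ℕ) :
    dPow k (α + Pi.single i 1) = d k i * dPow k α := ofFn_pow_mul _ d_comm i α

theorem xPow_zero : xPow k (0 : Fin n → ℕ) = 1 := by simp [xPow, List.ofFn_const]

theorem dPow_zero : dPow k (0 : Fin n → ℕ) = 1 := by simp [dPow, List.ofFn_const]

theorem exists_single_add {α : Fin n → ℕ} {m : ℕ} (h : ∑ i, α i = m + 1) :
    ∃ (i : Fin n) (γ : Fin n → ℕ), α = γ + Pi.single i 1 ∧ ∑ j, γ j = m := by
  obtain ⟨i, hi⟩ : ∃ i, α i ≠ 0 := by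
    by_contra! hc
    simp [hc] at h
  refine ⟨i, α - Pi.single i 1, ?_, ?_⟩
  · funext j
    by_cases hj : j = i
    · subst hj; simp; omega
    · simp [hj]
  · have : α = (α - Pi.single i 1) + Pi.single i 1 := by
      funext j
      by_cases hj : j = i
      · subst hj; simp; omega
      · simp [hj]
    rw [this] at h
    simp only [Pi.add_apply, Finset.sum_add_distrib, Finset.sum_pi_single', Finset.mem_univ,
      if_true] at h
    simpa using h

theorem sum_add_single (i : Fin n) (α : Fin n → ℕ) :
    ∑ j, (α + Pi.single i 1 : Fin n → ℕ) j = (∑ j, α j) + 1 := by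
  simp [Finset.sum_add_distrib]

theorem bernsteinSpan_mono : Monotone (bernsteinSpan k n) := fun _ _ h =>
  Submodule.span_mono fun _ ⟨α, β, h1, h2⟩ => ⟨α, β, h1.trans h, h2⟩

theorem monomial_mem {α β : Fin n → ℕ} {m : ℕ} (h : (∑ i, α i) + (∑ i, β i) ≤ m) :
    xPow k α * dPow k β ∈ bernsteinSpan k n m := Submodule.subset_span ⟨α, β, h, rfl⟩

theorem x_mul_mem (i : Fin n) {m : ℕ} {a : WeylAlgebra k n} (ha : a ∈ bernsteinSpan k n m) :
    x k i * a ∈ bernsteinSpan k n (m + 1) := by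
  induction ha using Submodule.span_induction with
  | mem a h =>
    obtain ⟨α, β, h, rfl⟩ := h
    rw [← mul_assoc, ← xPow_add_single]
    apply monomial_mem
    rw [sum_add_single]; omega
  | zero => simp
  | add a b _ _ h h' => rw [mul_add]; exact add_mem h h'
  | smul r a _ h => rw [mul_smul_comm]; exact Submodule.smul_mem _ _ h

theorem commutator_mem (i : Fin n) (β : Fin n → ℕ) : ∀ (m : ℕ) (α : Fin n → ℕ), ∑ j, α j = m →
    (d k i * xPow k α - xPow k α * d k i) * dPow k β ∈ bernsteinSpan k n (m + ∑ j, β j) := by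
  intro m
  induction m with
  | zero =>
    intro α h
    have : α = 0 := by
      funext j
      simpa using (Finset.sum_eq_zero_iff.1 h) j (Finset.mem_univ j)
    simp [this, xPow_zero]
  | succ m ih =>
    intro α h
    obtain ⟨j, γ, rfl, hγ⟩ := exists_single_add h
    have e : (d k i * xPow k (γ + Pi.single j 1) - xPow k (γ + Pi.single j 1) * d k i) * dPow k β
        = (d k i * x k j - x k j * d k i) * (xPow k γ * dPow k β)
          + x k j * ((d k i * xPow k γ - xPow k γ * d k i) * dPow k β) := by
      rw [xPow_add_single]; noncomm_ring
    rw [e, d_x]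
    refine add_mem ?_ ?_
    · split_ifs
      · rw [one_mul]; exact monomial_mem (by omega)
      · simp
    · have := x_mul_mem j (ih γ hγ)
      rwa [add_right_comm] at this

theorem d_mul_mem (i : Fin n) {m : ℕ} {a : WeylAlgebra k n} (ha : a ∈ bernsteinSpan k n m) :
    d k i * a ∈ bernsteinSpan k n (m + 1) := by
  induction ha using Submodule.span_induction with
  | mem a h =>
    obtain ⟨α, β, h, rfl⟩ := h
    have e : d k i * (xPow k α * dPow k β) = xPow k α * dPow k (β + Pi.single i 1)
        + (d k i * xPow k α - xPow k α * d k i) * dPow k β := by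
      rw [dPow_add_single]; noncomm_ring
    rw [e]
    refine add_mem (monomial_mem ?_) (bernsteinSpan_mono ?_ (commutator_mem i β _ α rfl))
    · rw [sum_add_single]; omega
    · omega
  | zero => simp
  | add a b _ _ h h' => rw [mul_add]; exact add_mem h h'
  | smul r a _ h => rw [mul_smul_comm]; exact Submodule.smul_mem _ _ h

theorem dPow_mul_mem {m : ℕ} {a : WeylAlgebra k n} (ha : a ∈ bernsteinSpan k n m) :
    ∀ (l : ℕ) (β : Fin n → ℕ), ∑ j, β j = l → dPow k β * a ∈ bernsteinSpan k n (l + m) := by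
  intro l
  induction l with
  | zero =>
    intro β h
    have : β = 0 := by
      funext j
      simpa using (Finset.sum_eq_zero_iff.1 h) j (Finset.mem_univ j)
    simpa [this, dPow_zero] using ha
  | succ l ih =>
    intro β h
    obtain ⟨j, γ, rfl, hγ⟩ := exists_single_add h
    rw [dPow_add_single, mul_assoc, add_right_comm]
    exact d_mul_mem j (ih γ hγ)

theorem xPow_mul_mem {m : ℕ} {a : WeylAlgebra k n} (ha : a ∈ bernsteinSpan k n m) :
    ∀ (l : ℕ) (α : Fin n → ℕ), ∑ j, α j = l → xPow k α * a ∈ bernsteinSpan k n (l + m) := by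
  intro l
  induction l with
  | zero =>
    intro α h
    have : α = 0 := by
      funext j
      simpa using (Finset.sum_eq_zero_iff.1 h) j (Finset.mem_univ j)
    simpa [this, xPow_zero] using ha
  | succ l ih =>
    intro α h
    obtain ⟨j, γ, rfl, hγ⟩ := exists_single_add h
    rw [xPow_add_single, mul_assoc, add_right_comm]
    exact x_mul_mem j (ih γ hγ)

theorem bernsteinSpan_mul_mem {i j : ℕ} {a b : WeylAlgebra k n}
    (ha : a ∈ bernsteinSpan k n i) (hb : b ∈ bernsteinSpan k n j) :
    a * b ∈ bernsteinSpan k n (i + j) := by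
  induction ha using Submodule.span_induction with
  | mem a h =>
    obtain ⟨α, β, h, rfl⟩ := h
    rw [mul_assoc]
    refine bernsteinSpan_mono ?_ (xPow_mul_mem (dPow_mul_mem hb _ β rfl) _ α rfl)
    omega
  | zero => simp
  | add a b _ _ h h' => rw [add_mul]; exact add_mem h h'
  | smul r a _ h => rw [smul_mul_assoc]; exact Submodule.smul_mem _ _ h

end Bernstein

end WeylAlgebra

/-! ### Filtrations and associated graded objects -/

section Graded

/-- The preceding step of an increasing sequence of subspaces (`0` for the first one). -/
def prevStep {k M : Type*} [Field k] [AddCommGroup M] [Module k M] (Γ : ℕ → Submodule k M) :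
    ℕ → Submodule k M
  | 0 => ⊥
  | i + 1 => Γ i

/-- The graded piece `Γ_i / Γ_{i-1}`, with `Γ_{-1} = 0`. -/
def GrPiece {k M : Type*} [Field k] [AddCommGroup M] [Module k M] (Γ : ℕ → Submodule k M)
    (i : ℕ) : Type _ :=
  Γ i ⧸ (prevStep Γ i).submoduleOf (Γ i)

namespace GrPiece

variable {k M : Type*} [Field k] [AddCommGroup M] [Module k M]

instance instAddCommGroup (Γ : ℕ → Submodule k M) (i : ℕ) : AddCommGroup (GrPiece Γ i) :=
  inferInstanceAs (AddCommGroup (Γ i ⧸ (prevStep Γ i).submoduleOf (Γ i)))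

instance instModule (Γ : ℕ → Submodule k M) (i : ℕ) : Module k (GrPiece Γ i) :=
  inferInstanceAs (Module k (Γ i ⧸ (prevStep Γ i).submoduleOf (Γ i)))

/-- The symbol map `Γ_i → Γ_i / Γ_{i-1}`. -/
def symbol (Γ : ℕ → Submodule k M) (i : ℕ) : Γ i →ₗ[k] GrPiece Γ i :=
  Submodule.mkQ ((prevStep Γ i).submoduleOf (Γ i))

theorem symbol_surjective (Γ : ℕ → Submodule k M) (i : ℕ) :
    Function.Surjective (symbol Γ i) := Submodule.mkQ_surjective _

theorem symbol_eq_zero {Γ : ℕ → Submodule k M} {i : ℕ} {a : Γ i} (h : (a : M) ∈ prevStep Γ i) :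
    symbol Γ i a = 0 := (Submodule.Quotient.mk_eq_zero _).2 h

theorem mk_symbol_eq {Γ : ℕ → Submodule k M} {i j : ℕ} (h : i = j) {a : Γ i} {b : Γ j}
    (hab : (a : M) = b) :
    GradedMonoid.mk (A := GrPiece Γ) i (symbol Γ i a) = GradedMonoid.mk j (symbol Γ j b) := by
  subst h
  rw [Subtype.ext hab]

variable {R : Type*} [Ring R] [Algebra k R] [Module R M] [IsScalarTower k R M]

/-- The symbol of `a • b`, for `a ∈ P_i` and `b ∈ Q_j`. -/
def actAux (P : ℕ → Submodule k R) (Q : ℕ → Submodule k M)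
    (h : ∀ i j, ∀ a ∈ P i, ∀ b ∈ Q j, a • b ∈ Q (i + j)) (i j : ℕ) :
    P i →ₗ[k] Q j →ₗ[k] GrPiece Q (i + j) :=
  LinearMap.mk₂ k (fun a b => symbol Q (i + j) ⟨(a : R) • (b : M), h i j a a.2 b b.2⟩)
    (fun a a' b => by
      rw [← map_add]; congr 1; ext; simp [add_smul])
    (fun c a b => by
      rw [← map_smul]; congr 1; ext; simp [smul_assoc])
    (fun a b b' => by
      rw [← map_add]; congr 1; ext; simp [smul_add])
    (fun c a b => by
      rw [← map_smul]; congr 1; exact Subtype.ext (smul_comm (a : R) c (b : M)))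

/-- The action `P_i / P_{i-1} × Q_j / Q_{j-1} → Q_{i+j} / Q_{i+j-1}` induced by `(a, b) ↦ a • b`. -/
def act (P : ℕ → Submodule k R) (Q : ℕ → Submodule k M)
    (h : ∀ i j, ∀ a ∈ P i, ∀ b ∈ Q j, a • b ∈ Q (i + j)) (i j : ℕ) :
    GrPiece P i →ₗ[k] GrPiece Q j →ₗ[k] GrPiece Q (i + j) :=
  have h2 : ∀ a : P i, (prevStep Q j).submoduleOf (Q j) ≤ LinearMap.ker (actAux P Q h i j a) := by
    intro a b hb
    refine symbol_eq_zero ?_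
    cases j with
    | zero =>
      have : (b : M) = 0 := hb
      simp [this]
    | succ j => exact h i j a a.2 b hb
  Submodule.liftQ ((prevStep P i).submoduleOf (P i))
    { toFun := fun a => Submodule.liftQ ((prevStep Q j).submoduleOf (Q j)) (actAux P Q h i j a) (h2 a)
      map_add' := fun a a' => by
        refine LinearMap.ext fun y => ?_
        obtain ⟨b, rfl⟩ := symbol_surjective Q j y
        exact congrArg (fun g => g b) (map_add (actAux P Q h i j) a a')
      map_smul' := fun c a => by
        refine LinearMap.ext fun y => ?_
        obtain ⟨b, rfl⟩ := symbol_surjective Q j y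
        exact congrArg (fun g => g b) (map_smul (actAux P Q h i j) c a) }
    (by
      intro a ha
      refine LinearMap.ext fun y => ?_
      obtain ⟨b, rfl⟩ := symbol_surjective Q j y
      refine symbol_eq_zero ?_
      cases i with
      | zero =>
        have : (a : R) = 0 := ha
        simp [this]
      | succ i =>
        have := h i j a ha b b.2
        change (a : R) • (b : M) ∈ prevStep Q (i + 1 + j)
        rw [Nat.add_right_comm]
        exact this)

theorem act_symbol (P : ℕ → Submodule k R) (Q : ℕ → Submodule k M)
    (h : ∀ i j, ∀ a ∈ P i, ∀ b ∈ Q j, a • b ∈ Q (i + j)) (i j : ℕ) (a : P i) (b : Q j) :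
    act P Q h i j (symbol P i a) (symbol Q j b)
      = symbol Q (i + j) ⟨(a : R) • (b : M), h i j a a.2 b b.2⟩ := rfl

end GrPiece

/-- An increasing filtration of a `k`-algebra `R` by subspaces, compatible with the
multiplication. -/
structure RingFiltration (k R : Type*) [Field k] [Ring R] [Algebra k R] where
  step : ℕ → Submodule k R
  mono : Monotone step
  one_mem : 1 ∈ step 0
  mul_mem : ∀ i j, ∀ a ∈ step i, ∀ b ∈ step j, a * b ∈ step (i + j)

/-- A filtration of a module `M` over a filtered algebra `R`: an increasing sequence of finite
dimensional subspaces `Γ_i` with union `M` such that `F_i Γ_j ⊆ Γ_{i+j}`. -/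
structure ModuleFiltration {k R : Type*} [Field k] [Ring R] [Algebra k R]
    (F : RingFiltration k R) (M : Type*) [AddCommGroup M] [Module k M] [Module R M] where
  step : ℕ → Submodule k M
  mono : Monotone step
  finiteDimensional : ∀ i, FiniteDimensional k (step i)
  exhaustive : ∀ m : M, ∃ i, m ∈ step i
  smul_mem : ∀ i j, ∀ a ∈ F.step i, ∀ m ∈ step j, a • m ∈ step (i + j)

variable {k R : Type*} [Field k] [Ring R] [Algebra k R]

/-- The graded pieces of `Gr_F(R)`. -/
def RingFiltration.Piece (F : RingFiltration k R) (i : ℕ) : Type _ := GrPiece F.step i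

instance RingFiltration.instAddCommGroupPiece (F : RingFiltration k R) (i : ℕ) :
    AddCommGroup (F.Piece i) := inferInstanceAs (AddCommGroup (GrPiece F.step i))

/-- The graded pieces of `Gr_Γ(M)`. -/
def ModuleFiltration.Piece {F : RingFiltration k R} {M : Type*} [AddCommGroup M] [Module k M]
    [Module R M] (Γ : ModuleFiltration F M) (i : ℕ) : Type _ := GrPiece Γ.step i

instance ModuleFiltration.instAddCommGroupPiece {F : RingFiltration k R} {M : Type*}
    [AddCommGroup M] [Module k M] [Module R M] (Γ : ModuleFiltration F M) (i : ℕ) :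
    AddCommGroup (Γ.Piece i) := inferInstanceAs (AddCommGroup (GrPiece Γ.step i))

/-- The graded multiplication of `Gr_F(R)`. -/
instance RingFiltration.instGMul (F : RingFiltration k R) : GradedMonoid.GMul F.Piece where
  mul {i j} a b := GrPiece.act F.step F.step F.mul_mem i j a b

instance RingFiltration.instGOne (F : RingFiltration k R) : GradedMonoid.GOne F.Piece where
  one := GrPiece.symbol F.step 0 ⟨1, F.one_mem⟩

instance RingFiltration.instGMonoid (F : RingFiltration k R) : GradedMonoid.GMonoid F.Piece where
  one_mul := by
    rintro ⟨i, a⟩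
    obtain ⟨a, rfl⟩ := GrPiece.symbol_surjective F.step i a
    exact GrPiece.mk_symbol_eq (zero_add i) (one_mul (a : R))
  mul_one := by
    rintro ⟨i, a⟩
    obtain ⟨a, rfl⟩ := GrPiece.symbol_surjective F.step i a
    exact GrPiece.mk_symbol_eq (add_zero i) (mul_one (a : R))
  mul_assoc := by
    rintro ⟨i, a⟩ ⟨j, b⟩ ⟨l, c⟩
    obtain ⟨a, rfl⟩ := GrPiece.symbol_surjective F.step i a
    obtain ⟨b, rfl⟩ := GrPiece.symbol_surjective F.step j b
    obtain ⟨c, rfl⟩ := GrPiece.symbol_surjective F.step l c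
    exact GrPiece.mk_symbol_eq (add_assoc i j l) (mul_assoc (a : R) b c)

/-- The graded ring structure of `Gr_F(R)`. -/
instance RingFiltration.instGSemiring (F : RingFiltration k R) : DirectSum.GSemiring F.Piece where
  mul_zero a := map_zero (GrPiece.act F.step F.step F.mul_mem _ _ a)
  zero_mul b := LinearMap.map_zero₂ (GrPiece.act F.step F.step F.mul_mem _ _) b
  mul_add a b c := map_add (GrPiece.act F.step F.step F.mul_mem _ _ a) b c
  add_mul a b c := LinearMap.map_add₂ (GrPiece.act F.step F.step F.mul_mem _ _) a b c
  natCast n := n • (GrPiece.symbol F.step 0 ⟨1, F.one_mem⟩ : GrPiece F.step 0)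
  natCast_zero := zero_nsmul _
  natCast_succ n := succ_nsmul _ n

/-- The graded module structure of `Gr_Γ(M)` over `Gr_F(R)`. -/
instance ModuleFiltration.instGmodule {F : RingFiltration k R} {M : Type*} [AddCommGroup M]
    [Module k M] [Module R M] [IsScalarTower k R M] (Γ : ModuleFiltration F M) :
    DirectSum.Gmodule F.Piece Γ.Piece where
  smul {i j} a b := GrPiece.act F.step Γ.step Γ.smul_mem i j a b
  smul_zero a := map_zero (GrPiece.act F.step Γ.step Γ.smul_mem _ _ a)
  zero_smul b := LinearMap.map_zero₂ (GrPiece.act F.step Γ.step Γ.smul_mem _ _) b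
  smul_add a b c := map_add (GrPiece.act F.step Γ.step Γ.smul_mem _ _ a) b c
  add_smul a b c := LinearMap.map_add₂ (GrPiece.act F.step Γ.step Γ.smul_mem _ _) a b c
  one_smul := by
    rintro ⟨i, a⟩
    obtain ⟨a, rfl⟩ := GrPiece.symbol_surjective Γ.step i a
    exact GrPiece.mk_symbol_eq (zero_add i) (one_smul R (a : M))
  mul_smul := by
    rintro ⟨i, a⟩ ⟨j, b⟩ ⟨l, c⟩
    obtain ⟨a, rfl⟩ := GrPiece.symbol_surjective F.step i a
    obtain ⟨b, rfl⟩ := GrPiece.symbol_surjective F.step j b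
    obtain ⟨c, rfl⟩ := GrPiece.symbol_surjective Γ.step l c
    exact GrPiece.mk_symbol_eq (add_assoc i j l) (mul_smul (a : R) (b : R) (c : M))

/-- The symbol map `F_i → F_i / F_{i-1} ⊆ Gr_F(R)`. -/
def RingFiltration.symbol (F : RingFiltration k R) (i : ℕ) : F.step i →+ F.Piece i :=
  (GrPiece.symbol F.step i).toAddMonoidHom

/-- The symbol map `Γ_i → Γ_i / Γ_{i-1} ⊆ Gr_Γ(M)`. -/
def ModuleFiltration.symbol {F : RingFiltration k R} {M : Type*} [AddCommGroup M]
    [Module k M] [Module R M] (Γ : ModuleFiltration F M) (i : ℕ) : Γ.step i →+ Γ.Piece i :=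
  (GrPiece.symbol Γ.step i).toAddMonoidHom

theorem RingFiltration.of_symbol_mul (F : RingFiltration k R) (i j : ℕ) (a : F.step i)
    (b : F.step j) :
    DirectSum.of F.Piece i (F.symbol i a) * DirectSum.of F.Piece j (F.symbol j b)
      = DirectSum.of F.Piece (i + j)
          (F.symbol (i + j) ⟨(a : R) * (b : R), F.mul_mem i j a a.2 b b.2⟩) := by
  rw [DirectSum.of_mul_of]
  rfl

theorem ModuleFiltration.of_symbol_smul {F : RingFiltration k R} {M : Type*} [AddCommGroup M]
    [Module k M] [Module R M] [IsScalarTower k R M] (Γ : ModuleFiltration F M) (i j : ℕ)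
    (a : F.step i) (m : Γ.step j) :
    DirectSum.of F.Piece i (F.symbol i a) • DirectSum.of Γ.Piece j (Γ.symbol j m)
      = DirectSum.of Γ.Piece (i + j)
          (Γ.symbol (i + j) ⟨(a : R) • (m : M), Γ.smul_mem i j a a.2 m m.2⟩) := by
  rw [DirectSum.Gmodule.of_smul_of]
  rfl

/-- A filtration `Γ` is good if `Gr_Γ(M)` is a finitely generated module over `Gr_F(R)`. -/
def ModuleFiltration.IsGood {F : RingFiltration k R} {M : Type*} [AddCommGroup M]
    [Module k M] [Module R M] [IsScalarTower k R M] (Γ : ModuleFiltration F M) : Prop :=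
  Module.Finite (⨁ i, F.Piece i) (⨁ i, Γ.Piece i)

end Graded

/-! ### Holonomic modules -/

/-- The Bernstein filtration of `A_n(k)`. -/
def WeylAlgebra.bernstein (k : Type*) [Field k] (n : ℕ) : RingFiltration k (WeylAlgebra k n) where
  step := WeylAlgebra.bernsteinSpan k n
  mono := WeylAlgebra.bernsteinSpan_mono
  one_mem := Submodule.subset_span
    ⟨0, 0, by simp, by rw [WeylAlgebra.xPow_zero, WeylAlgebra.dPow_zero, one_mul]⟩
  mul_mem _ _ _ ha _ hb := WeylAlgebra.bernsteinSpan_mul_mem ha hb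

section Holonomic

variable (k : Type*) [Field k] (n : ℕ) (M : Type*) [AddCommGroup M] [Module k M]

/-- `dim(M) = δ`: for a good filtration `Γ` of `M`, there is a polynomial `p` of degree `δ` with
`dim_k Γ_i = p(i)` for all large `i`. (The degree does not depend on the good filtration.) -/
def HasBernsteinDim [Module (WeylAlgebra k n) M] [IsScalarTower k (WeylAlgebra k n) M]
    (δ : ℕ) : Prop :=
  ∃ Γ : ModuleFiltration (WeylAlgebra.bernstein k n) M, Γ.IsGood ∧
    ∃ p : Polynomial ℚ, p.degree = δ ∧
      ∀ᶠ i : ℕ in Filter.atTop, (Module.finrank k (Γ.step i) : ℚ) = p.eval (i : ℚ)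

/-- A left `A_n(k)`-module is holonomic if it is finitely generated and either zero or of
dimension `n`. -/
def IsHolonomic [Module (WeylAlgebra k n) M] [IsScalarTower k (WeylAlgebra k n) M] : Prop :=
  Module.Finite (WeylAlgebra k n) M ∧ (Subsingleton M ∨ HasBernsteinDim k n M n)

end Holonomic

/-! ### Bimodules

A bimodule over a `k`-algebra `A` is a `k`-vector space `M` with commuting `k`-compatible actions of
`A` (on the left) and of `Aᵐᵒᵖ` (that is, of `A` on the right). -/

section Bimodule

variable (k A M : Type*) [Field k] [Ring A] [Algebra k A] [AddCommGroup M] [Module k M]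
  [Module A M] [Module Aᵐᵒᵖ M] [IsScalarTower k A M] [IsScalarTower k Aᵐᵒᵖ M]
  [SMulCommClass A Aᵐᵒᵖ M]

/-- A bimodule as a left module over `Aᵉ = A ⊗ Aᵒᵖ`, through `(a ⊗ b) m = a m b`. -/
abbrev envelopingModule : Module (A ⊗[k] Aᵐᵒᵖ) M := TensorProduct.Algebra.module

/-- A bimodule is simple if it is nonzero and has no proper nonzero subbimodules, that is, if it
is a simple `Aᵉ`-module. -/
def IsSimpleBimodule : Prop :=
  letI := envelopingModule k A M
  IsSimpleModule (A ⊗[k] Aᵐᵒᵖ) M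

end Bimodule

section HolonomicBimodule

variable (k : Type*) [Field k] (n : ℕ) (M : Type*) [AddCommGroup M] [Module k M]
  [Module (WeylAlgebra k n) M] [Module (WeylAlgebra k n)ᵐᵒᵖ M]
  [IsScalarTower k (WeylAlgebra k n) M] [IsScalarTower k (WeylAlgebra k n)ᵐᵒᵖ M]
  [SMulCommClass (WeylAlgebra k n) (WeylAlgebra k n)ᵐᵒᵖ M]

/-- A bimodule over `A_n(k)` as a left module over `A_{2n}(k) ≅ A_n(k) ⊗ A_n(k)ᵒᵖ`. -/
abbrev doubleModule : Module (WeylAlgebra k (n + n)) M :=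
  letI := envelopingModule k (WeylAlgebra k n) M
  Module.compHom M (WeylAlgebra.envelopingEquiv k n).symm.toAlgHom.toRingHom

theorem doubleModule_isScalarTower :
    letI := doubleModule k n M
    IsScalarTower k (WeylAlgebra k (n + n)) M := by
  let := envelopingModule k (WeylAlgebra k n) M
  let := doubleModule k n M
  refine ⟨fun r a m => ?_⟩
  change (WeylAlgebra.envelopingEquiv k n).symm (r • a) • m
    = r • ((WeylAlgebra.envelopingEquiv k n).symm a • m)
  rw [map_smul]
  exact congrArg (fun g => g m) (map_smul (TensorProduct.Algebra.moduleAux (R := k)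
    (A := WeylAlgebra k n) (B := (WeylAlgebra k n)ᵐᵒᵖ) (M := M)) r _)

/-- A bimodule over `A_n(k)` is holonomic if it is holonomic as a left module over `A_{2n}(k)`. -/
def IsHolonomicBimodule : Prop :=
  letI := doubleModule k n M
  haveI := doubleModule_isScalarTower k n M
  IsHolonomic k (n + n) M

end HolonomicBimodule

/-! ### The graph and the dual graph of an endomorphism -/

section Graph

variable {k A : Type*} [Field k] [Ring A] [Algebra k A]

/-- The graph `A^f`: the bimodule `A` with right action twisted by `f`, `a m s = a * m * f s`. -/
def EndGraph (_f : A →ₐ[k] A) : Type _ := A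

/-- The dual graph `ᶠA`: the bimodule `A` with left action twisted by `f`,
`a m s = f a * m * s`. -/
def EndDualGraph (_f : A →ₐ[k] A) : Type _ := A

namespace EndGraph

variable (f : A →ₐ[k] A)

instance instAddCommGroup : AddCommGroup (EndGraph f) := inferInstanceAs (AddCommGroup A)

instance instModuleBase : Module k (EndGraph f) := inferInstanceAs (Module k A)

instance instModuleLeft : Module A (EndGraph f) := inferInstanceAs (Module A A)

instance instModuleRight : Module Aᵐᵒᵖ (EndGraph f) :=
  Module.compHom A (AlgHom.op f : Aᵐᵒᵖ →+* Aᵐᵒᵖ)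

/-- The identification of the underlying vector space with `A`. -/
def of : A ≃ₗ[k] EndGraph f := LinearEquiv.refl k A

theorem left_smul_def (a m : A) : a • of f m = of f (a * m) := rfl

theorem right_smul_def (s m : A) : MulOpposite.op s • of f m = of f (m * f s) := rfl

instance instIsScalarTowerLeft : IsScalarTower k A (EndGraph f) := inferInstanceAs (IsScalarTower k A A)

instance instIsScalarTowerRight : IsScalarTower k Aᵐᵒᵖ (EndGraph f) where
  smul_assoc r s m := by
    obtain ⟨m, rfl⟩ := (of f).surjective m
    change of f (m * f (r • s.unop)) = r • of f (m * f s.unop)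
    rw [map_smul, mul_smul_comm, map_smul]

instance instSMulCommClass : SMulCommClass A Aᵐᵒᵖ (EndGraph f) where
  smul_comm a s m := (mul_assoc a (m : A) (f s.unop)).symm

end EndGraph

namespace EndDualGraph

variable (f : A →ₐ[k] A)

instance instAddCommGroup : AddCommGroup (EndDualGraph f) := inferInstanceAs (AddCommGroup A)

instance instModuleBase : Module k (EndDualGraph f) := inferInstanceAs (Module k A)

instance instModuleLeft : Module A (EndDualGraph f) := Module.compHom A (f : A →+* A)

instance instModuleRight : Module Aᵐᵒᵖ (EndDualGraph f) := inferInstanceAs (Module Aᵐᵒᵖ A)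

/-- The identification of the underlying vector space with `A`. -/
def of : A ≃ₗ[k] EndDualGraph f := LinearEquiv.refl k A

theorem left_smul_def (a m : A) : a • of f m = of f (f a * m) := rfl

theorem right_smul_def (s m : A) : MulOpposite.op s • of f m = of f (m * s) := rfl

instance instIsScalarTowerLeft : IsScalarTower k A (EndDualGraph f) where
  smul_assoc r a m := by
    obtain ⟨m, rfl⟩ := (of f).surjective m
    change of f (f (r • a) * m) = r • of f (f a * m)
    rw [map_smul, smul_mul_assoc, map_smul]

instance instIsScalarTowerRight : IsScalarTower k Aᵐᵒᵖ (EndDualGraph f) :=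
  inferInstanceAs (IsScalarTower k Aᵐᵒᵖ A)

instance instSMulCommClass : SMulCommClass A Aᵐᵒᵖ (EndDualGraph f) where
  smul_comm a s m := (mul_assoc (f a) (m : A) s.unop).symm

end EndDualGraph

end Graph

end

/-!
The graph and the dual graph of `f` are analysed together, as modules over `A_{2n}(k)` whose
underlying space is identified with a polynomial ring in `2n` variables by normal ordering `x^α ∂^β`
(`IsPolynomialChart`).
Generators of `A_{2n}(k)` act by left and right multiplications by elements of `A_n(k)` of bounded
degree, so the degree filtration has growth of order `2n`. One of the two sides, the untwisted one,
acts as multiplication by the variables up to terms of lower degree; hence the leading exponents of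
a submodule form an upper set (`MvPolynomial.exists_isLowerSet_finrank_map_eq`).

The other ingredient is Bernstein's inequality (`exists_polynomial_finrank_cyclicStep`). If `m₀ ≠ 0`
then `B_i` embeds into `Hom(B_i m₀, B_{2i} m₀)`, since taking commutators with the generators amounts
to differentiating the normally ordered polynomial, and in characteristic zero a nonzero element is
reduced to a nonzero scalar in this way. Hence over `A_N(k)` the dimension of `B_i m₀` grows with
order at least `N`. That it is eventually polynomial follows from counting the exponents that are not
leading exponents of the annihilator of `m₀` (`eventuallyPolynomial_degreeCount`), by Dickson's lemma.

Simplicity (`IsPolynomialChart.isSimpleModule`): a nonzero submodule `I` has a leading exponent `e`,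
so the translate `e + ℕ^{2n}` is missing from the exponents of the quotient by `I`, whose growth then
has order less than `2n`; by Bernstein's inequality the quotient vanishes. Holonomicity
(`IsPolynomialChart.isHolonomic`): a simple module is cyclic, the filtration `B_i m₀` is good, and
its Hilbert polynomial has degree at most `2n` by the degree filtration and at least `2n` by
Bernstein's inequality.
-/

/-! ### Counting lattice points of lower sets -/

section Counting

open Polynomial Filter

/-- Summation preserves polynomial functions. -/
theorem Polynomial.exists_eval_eq_sum_range (p : ℚ[X]) :
    ∃ P : ℚ[X], ∀ n : ℕ, P.eval (n : ℚ) = ∑ i ∈ Finset.range n, p.eval (i : ℚ) := by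
  induction p using Polynomial.induction_on' with
  | add p q hp hq =>
    obtain ⟨P, hP⟩ := hp
    obtain ⟨Q, hQ⟩ := hq
    exact ⟨P + Q, fun n => by simp [hP, hQ, Finset.sum_add_distrib]⟩
  | monomial d a =>
    refine ⟨C a * ∑ i ∈ Finset.range (d + 1),
      C (_root_.bernoulli i * ((d + 1).choose i) / (d + 1)) * X ^ (d + 1 - i), fun n => ?_⟩
    simp only [eval_monomial, ← Finset.mul_sum, sum_range_pow, eval_mul, eval_C, eval_finsetSum,
      eval_pow, eval_X]
    congr 1
    exact Finset.sum_congr rfl fun i _ => by ring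

/-- A function `ℕ → ℕ` that agrees with a rational polynomial for all large arguments. -/
def EventuallyPolynomial (h : ℕ → ℕ) : Prop :=
  ∃ p : ℚ[X], ∀ᶠ i : ℕ in atTop, (h i : ℚ) = p.eval (i : ℚ)

theorem EventuallyPolynomial.sum {ι : Type*} {s : Finset ι} {h : ι → ℕ → ℕ}
    (H : ∀ t ∈ s, EventuallyPolynomial (h t)) :
    EventuallyPolynomial fun i => ∑ t ∈ s, h t i := by
  choose! p hp using H
  refine ⟨∑ t ∈ s, p t, ?_⟩
  filter_upwards [(eventually_all_finset s).2 hp] with i hi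
  rw [eval_finsetSum, Nat.cast_sum]
  exact Finset.sum_congr rfl hi

theorem EventuallyPolynomial.add {h g : ℕ → ℕ} (hh : EventuallyPolynomial h)
    (hg : EventuallyPolynomial g) : EventuallyPolynomial fun i => h i + g i := by
  obtain ⟨p, hp⟩ := hh
  obtain ⟨q, hq⟩ := hg
  refine ⟨p + q, ?_⟩
  filter_upwards [hp, hq] with i h1 h2
  simp [h1, h2]

theorem EventuallyPolynomial.comp_sub {h : ℕ → ℕ} (hh : EventuallyPolynomial h) (t : ℕ) :
    EventuallyPolynomial fun i => h (i - t) := by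
  obtain ⟨p, hp⟩ := hh
  refine ⟨p.comp (X - C (t : ℚ)), ?_⟩
  filter_upwards [(tendsto_sub_atTop_nat t).eventually hp, eventually_ge_atTop t] with i hi hit
  simp [hi, Nat.cast_sub hit]

theorem EventuallyPolynomial.sum_range {h : ℕ → ℕ} (hh : EventuallyPolynomial h) :
    EventuallyPolynomial fun i => ∑ s ∈ Finset.range i, h s := by
  obtain ⟨p, hp⟩ := hh
  obtain ⟨P, hP⟩ := p.exists_eval_eq_sum_range
  obtain ⟨T, hT⟩ := eventually_atTop.1 hp
  refine ⟨P + C ((∑ s ∈ Finset.range T, (h s : ℚ)) - P.eval (T : ℚ)), ?_⟩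
  filter_upwards [eventually_ge_atTop T] with i hi
  have key : ∑ s ∈ Finset.Ico T i, (h s : ℚ) = ∑ s ∈ Finset.Ico T i, p.eval (s : ℚ) :=
    Finset.sum_congr rfl fun s hs => hT s (Finset.mem_Ico.1 hs).1
  rw [Nat.cast_sum, ← Finset.sum_range_add_sum_Ico _ hi, key, eval_add, eval_C, hP, hP,
    ← Finset.sum_range_add_sum_Ico _ hi]
  ring

/-- The number of elements of `S` of degree at most `i`. -/
noncomputable def degreeCount {σ : Type*} (S : Set (σ →₀ ℕ)) (i : ℕ) : ℕ :=
  Nat.card {e : σ →₀ ℕ // e ∈ S ∧ e.degree ≤ i}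

theorem finite_degree_le {σ : Type*} [Finite σ] (S : Set (σ →₀ ℕ)) (i : ℕ) :
    Finite {e : σ →₀ ℕ // e ∈ S ∧ e.degree ≤ i} :=
  ((Finsupp.finite_of_degree_le i).subset fun _ h => h.2 :
    {e : σ →₀ ℕ | e ∈ S ∧ e.degree ≤ i}.Finite).to_subtype

/-- Dickson's lemma for lower sets: a descending sequence of lower sets of exponents stabilizes. -/
theorem exists_eq_of_antitone_isLowerSet {σ : Type*} [Finite σ] {S : ℕ → Set (σ →₀ ℕ)}
    (hS : ∀ t, IsLowerSet (S t)) (hanti : Antitone S) : ∃ T, ∀ t, T ≤ t → S t = S T := by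
  -- The minimal elements of the upper set `{(t, e) | e ∉ S t}` form an antichain, which is finite.
  let P : ℕ × (σ →₀ ℕ) → Prop := fun q => q.2 ∉ S q.1
  have hfin : {q | Minimal P q}.Finite :=
    WellQuasiOrderedLE.finite_of_isAntichain (setOfPred_minimal_antichain P)
  obtain ⟨T, hT⟩ := (hfin.image Prod.fst).bddAbove
  refine ⟨T, fun t ht => (hanti ht).antisymm fun e he => ?_⟩
  by_contra hc
  obtain ⟨q, hq, hmin⟩ := exists_minimal_le_of_wellFoundedLT P (t, e) hc
  have hqT : q.1 ≤ T := hT ⟨q, hmin, rfl⟩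
  exact hmin.prop (hanti hqT (hS T hq.2 he))

theorem Finsupp.degree_cons {m : ℕ} (t : ℕ) (e : Fin m →₀ ℕ) :
    (Finsupp.cons t e).degree = t + e.degree := by
  simp [Finsupp.degree_eq_sum, Fin.sum_univ_succ]

theorem Finsupp.cons_le_cons {m : ℕ} {t t' : ℕ} {e e' : Fin m →₀ ℕ} (ht : t ≤ t') (he : e ≤ e') :
    Finsupp.cons t e ≤ Finsupp.cons t' e' := by
  intro s
  cases s using Fin.cases with
  | zero => simpa using ht
  | succ s => simpa using he s

/-- Slicing by the value of the first exponent. -/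
theorem degreeCount_eq_sum {m : ℕ} (S : Set (Fin (m + 1) →₀ ℕ)) (i : ℕ) :
    degreeCount S i = ∑ t ∈ Finset.range (i + 1), degreeCount {e | Finsupp.cons t e ∈ S} (i - t) := by
  have := fun t : Fin (i + 1) => finite_degree_le {e | Finsupp.cons (t : ℕ) e ∈ S} (i - t)
  rw [← Fin.sum_univ_eq_sum_range (fun t => degreeCount {e | Finsupp.cons t e ∈ S} (i - t))]
  unfold degreeCount
  rw [← Nat.card_sigma]
  refine Nat.card_congr
    { toFun := fun e => ⟨⟨e.1 0, ?_⟩, ⟨e.1.tail, ?_, ?_⟩⟩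
      invFun := fun q => ⟨Finsupp.cons q.1 q.2.1, q.2.2.1, ?_⟩
      left_inv := fun e => Subtype.ext (Finsupp.cons_tail e.1)
      right_inv := ?_ }
  · have := Finsupp.le_degree 0 e.1
    have := e.2.2
    omega
  · have := e.2.1
    rw [← Finsupp.cons_tail e.1] at this
    exact this
  · have := e.2.2
    rw [← Finsupp.cons_tail e.1, Finsupp.degree_cons] at this
    exact Nat.le_sub_of_add_le' this
  · have h1 := q.1.2
    have h2 := q.2.2.2
    rw [Finsupp.degree_cons]
    omega
  · rintro ⟨⟨t, ht⟩, ⟨e, h1, h2⟩⟩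
    have h0 : (Finsupp.cons t e) 0 = t := Finsupp.cons_zero t e
    have h3 : (Finsupp.cons t e).tail = e := Finsupp.tail_cons t e
    refine Sigma.ext (Fin.ext h0) ?_
    dsimp only
    congr!

theorem degreeCount_fin_univ (m i : ℕ) :
    degreeCount (Set.univ : Set (Fin m →₀ ℕ)) i = (i + m).choose m := by
  induction m generalizing i with
  | zero =>
    have : Unique {e : Fin 0 →₀ ℕ // e ∈ (Set.univ : Set (Fin 0 →₀ ℕ)) ∧ e.degree ≤ i} :=
      { default := ⟨0, trivial, by simp⟩
        uniq := fun e => Subtype.ext (Subsingleton.elim _ _) }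
    rw [degreeCount, Nat.card_unique]
    simp
  | succ m ih =>
    rw [degreeCount_eq_sum]
    have h : ∀ t, {e : Fin m →₀ ℕ | Finsupp.cons t e ∈ (Set.univ : Set (Fin (m + 1) →₀ ℕ))}
        = Set.univ := fun t => rfl
    simp only [h, ih]
    rw [show i + (m + 1) = i + m + 1 from rfl, ← Nat.sum_range_add_choose,
      ← Finset.sum_range_reflect (fun t => (t + m).choose m)]
    rfl

theorem eventuallyPolynomial_degreeCount_fin (m : ℕ) {S : Set (Fin m →₀ ℕ)} (hS : IsLowerSet S) :
    EventuallyPolynomial (degreeCount S) := by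
  induction m with
  | zero =>
    refine ⟨C (degreeCount S 0 : ℚ), Eventually.of_forall fun i => ?_⟩
    have h : ∀ e : Fin 0 →₀ ℕ, e.degree = 0 := fun e => by simp [Finsupp.degree_eq_sum]
    simp [degreeCount, h]
  | succ m ih =>
    let D : ℕ → Set (Fin m →₀ ℕ) := fun t => {e | Finsupp.cons t e ∈ S}
    have hD : ∀ t, IsLowerSet (D t) := fun t e e' hle he => hS (Finsupp.cons_le_cons le_rfl hle) he
    have hanti : Antitone D := fun t t' hle e he => hS (Finsupp.cons_le_cons hle le_rfl) he
    obtain ⟨T, hT⟩ := exists_eq_of_antitone_isLowerSet hD hanti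
    have h1 : EventuallyPolynomial fun i => ∑ t ∈ Finset.range T, degreeCount (D t) (i - t) :=
      EventuallyPolynomial.sum fun t _ => (ih (hD t)).comp_sub t
    -- The slices beyond `T` all agree, and contribute a partial sum of a single counting function.
    have h2 : EventuallyPolynomial fun i =>
        ∑ s ∈ Finset.range (i - T), degreeCount (D T) s + degreeCount (D T) (i - T) :=
      ((ih (hD T)).sum_range.comp_sub T).add ((ih (hD T)).comp_sub T)
    obtain ⟨p, hp⟩ := h1.add h2
    refine ⟨p, ?_⟩
    filter_upwards [hp, eventually_ge_atTop T] with i hi hiT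
    rw [← hi, degreeCount_eq_sum, ← Finset.sum_range_succ,
      ← Finset.sum_range_add_sum_Ico _ (show T ≤ i + 1 by omega)]
    congr 2
    rw [Finset.sum_Ico_eq_sum_range, ← Finset.sum_range_reflect,
      show i + 1 - T = i - T + 1 by omega]
    refine Finset.sum_congr rfl fun s hs => ?_
    have := Finset.mem_range.1 hs
    change degreeCount (D _) _ = _
    rw [hT _ (by omega)]
    congr 1
    omega

theorem degreeCount_domCongr {σ τ : Type*} (f : σ ≃ τ) (S : Set (σ →₀ ℕ)) (i : ℕ) :
    degreeCount S i = degreeCount {e : τ →₀ ℕ | Finsupp.equivMapDomain f.symm e ∈ S} i := by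
  refine Nat.card_congr ((Finsupp.equivCongrLeft f).subtypeEquiv fun e => ?_)
  have h : Finsupp.equivMapDomain f.symm (Finsupp.equivMapDomain f e) = e := by
    ext; simp
  have h2 : (Finsupp.equivMapDomain f e).degree = e.degree := by
    rw [Finsupp.equivMapDomain_eq_mapDomain, Finsupp.degree_mapDomain]
  simp [h, h2]

theorem degreeCount_univ (σ : Type*) [Finite σ] (i : ℕ) :
    degreeCount (Set.univ : Set (σ →₀ ℕ)) i = (i + Nat.card σ).choose (Nat.card σ) := by
  rw [degreeCount_domCongr (Finite.equivFin σ)]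
  exact degreeCount_fin_univ _ i

/-- The Hilbert function of a lower set of exponents is eventually polynomial. -/
theorem eventuallyPolynomial_degreeCount {σ : Type*} [Finite σ] {S : Set (σ →₀ ℕ)}
    (hS : IsLowerSet S) : EventuallyPolynomial (degreeCount S) := by
  have h := eventuallyPolynomial_degreeCount_fin _
    (S := {e | Finsupp.equivMapDomain (Finite.equivFin σ).symm e ∈ S})
    fun e e' hle he => hS (fun s => by simpa using hle _) he
  rwa [← funext (degreeCount_domCongr (Finite.equivFin σ) S)] at h

/-- Missing one exponent `e₀` removes the translate `e₀ + ℕ^σ` from a lower set. -/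
theorem degreeCount_add_le {σ : Type*} [Finite σ] {S : Set (σ →₀ ℕ)} (hS : IsLowerSet S)
    {e₀ : σ →₀ ℕ} (he₀ : e₀ ∉ S) (i : ℕ) :
    degreeCount S (i + e₀.degree) + degreeCount (Set.univ : Set (σ →₀ ℕ)) i
      ≤ degreeCount (Set.univ : Set (σ →₀ ℕ)) (i + e₀.degree) := by
  have := finite_degree_le S (i + e₀.degree)
  have := finite_degree_le (Set.univ : Set (σ →₀ ℕ)) i
  have := finite_degree_le (Set.univ : Set (σ →₀ ℕ)) (i + e₀.degree)
  unfold degreeCount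
  rw [← Nat.card_sum]
  refine Nat.card_le_card_of_injective (Sum.elim (fun e => ⟨e.1, trivial, e.2.2⟩)
    (fun e => ⟨e.1 + e₀, trivial, by have := e.2.2; rw [map_add]; omega⟩)) ?_
  refine Function.Injective.sumElim ?_ ?_ ?_
  · exact fun e e' h => Subtype.ext (congrArg (fun q => q.1) h)
  · exact fun e e' h => Subtype.ext (add_right_cancel (congrArg (fun q => q.1) h))
  · intro e e' h
    have h' : e.1 = e'.1 + e₀ := congrArg (fun q => q.1) h
    exact he₀ (hS (h' ▸ le_add_self) e.2.1)

end Counting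

/-! ### Leading exponents and Hilbert functions of filtered quotients -/

section LeadingExponents

open MvPolynomial

variable {k : Type*} [Field k] {σ : Type*}

/-- A map that is injective on the span of the monomials from `S` of degree at most `i` has an image
of dimension `degreeCount S i` there. -/
theorem MvPolynomial.finrank_map_restrictSupport [Finite σ] {V : Type*} [AddCommGroup V]
    [Module k V] (φ : MvPolynomial σ k →ₗ[k] V) (S : Set (σ →₀ ℕ)) (i : ℕ)
    (hφ : ∀ p ∈ restrictSupport k (S ∩ {e | e.degree ≤ i}), φ p = 0 → p = 0) :
    Module.finrank k ((restrictSupport k (S ∩ {e | e.degree ≤ i})).map φ) = degreeCount S i := by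
  rw [← LinearMap.range_domRestrict, LinearMap.finrank_range_of_inj,
    Module.finrank_eq_nat_card_basis (basisRestrictSupport k _)]
  · rfl
  · rw [injective_iff_map_eq_zero]
    exact fun p hp => Subtype.ext (hφ p.1 p.2 hp)

theorem MvPolynomial.restrictTotalDegree_eq_restrictSupport (i : ℕ) :
    restrictTotalDegree σ k i = restrictSupport k (Set.univ ∩ {e | e.degree ≤ i}) := by
  rw [Set.univ_inter]
  rfl

/-- Let the kernel of `φ` be stable under multiplication by each variable up to terms of lower
degree. The exponents which are not leading exponents of the kernel form a lower set, and the
images of the corresponding monomials are bases of the images of the degree filtration. -/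
theorem MvPolynomial.exists_isLowerSet_finrank_map_eq [Finite σ] {V : Type*} [AddCommGroup V]
    [Module k V] (φ : MvPolynomial σ k →ₗ[k] V)
    (hφ : ∀ s p, φ p = 0 → ∃ r, r.totalDegree ≤ p.totalDegree ∧ φ (X s * p + r) = 0) :
    ∃ S : Set (σ →₀ ℕ), IsLowerSet S ∧
      (∀ i, Module.finrank k ((restrictTotalDegree σ k i).map φ) = degreeCount S i) ∧
      ∀ p, φ p = 0 → p ≠ 0 → ∃ e, e ∉ S := by
  let : LinearOrder σ := LinearOrder.lift' (Finite.equivFin σ) (Finite.equivFin σ).injective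
  let m : MonomialOrder σ := MonomialOrder.degLex
  have hlt : ∀ p q : MvPolynomial σ k, p.totalDegree < q.totalDegree →
      m.toSyn (m.degree p) < m.toSyn (m.degree q) := fun p q h => by
    by_contra hc
    exact absurd (degLex_totalDegree_monotone (not_lt.1 hc)) (not_le.2 h)
  let S : Set (σ →₀ ℕ) := {e | ∀ p, φ p = 0 → p ≠ 0 → m.degree p ≠ e}
  have hX : ∀ e ∉ S, ∀ s, e + Finsupp.single s 1 ∉ S := by
    intro e he s hs
    simp only [S, Set.mem_ofPred_eq] at he
    push Not at he
    obtain ⟨p, hp, hp0, rfl⟩ := he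
    obtain ⟨r, hr, hpr⟩ := hφ s p hp
    have hXp : (X s * p).totalDegree = p.totalDegree + 1 := by
      rw [totalDegree_mul_of_isDomain (X_ne_zero s) hp0, totalDegree_X, add_comm]
    have hd : m.degree (X s * p + r) = m.degree p + Finsupp.single s 1 := by
      rw [m.degree_add_of_lt (hlt r (X s * p) (by omega)), m.degree_mul (X_ne_zero s) hp0,
        m.degree_X, add_comm]
    refine hs _ hpr ?_ hd
    intro h0
    rw [h0, m.degree_zero] at hd
    have := DFunLike.congr_fun hd s
    simp at this
  have hup : ∀ d e : σ →₀ ℕ, e ∉ S → e + d ∉ S := by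
    intro d
    induction d using Finsupp.induction_linear with
    | zero => simp
    | add d d' h h' => exact fun e he => by rw [← add_assoc]; exact h' _ (h _ he)
    | single s t =>
      induction t with
      | zero => simp
      | succ t ih =>
        intro e he
        rw [Finsupp.single_add, ← add_assoc]
        exact hX _ (ih _ he) s
  -- Reduction modulo the kernel: every image is that of a combination of monomials from `S`.
  have hred : ∀ i (a : m.syn) (p : MvPolynomial σ k), p.totalDegree ≤ i →
      m.toSyn (m.degree p) = a →
      φ p ∈ (restrictSupport k (S ∩ {e | e.degree ≤ i})).map φ := by
    intro i a
    induction a using WellFoundedLT.induction with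
    | ind a ih =>
      intro p hpi hpa
      by_cases hp0 : p = 0
      · rw [hp0, map_zero]
        exact zero_mem _
      have hei : (m.degree p).degree ≤ i := degree_degLexDegree.trans_le hpi
      -- Subtracting a multiple of a polynomial with the same leading exponent lowers the latter.
      have step : ∀ g : MvPolynomial σ k, g ≠ 0 → m.degree g = m.degree p →
          φ g ∈ (restrictSupport k (S ∩ {e | e.degree ≤ i})).map φ →
          φ p ∈ (restrictSupport k (S ∩ {e | e.degree ≤ i})).map φ := by
        intro g hg0 hg hgm
        have hgc : m.leadingCoeff g ≠ 0 := m.leadingCoeff_ne_zero_iff.2 hg0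
        let c : k := m.leadingCoeff p / m.leadingCoeff g
        have hgi : g.totalDegree ≤ i := by
          rw [← degree_degLexDegree]
          exact (congrArg _ hg).trans_le hei
        have hsub : φ (p - c • g) ∈ (restrictSupport k (S ∩ {e | e.degree ≤ i})).map φ := by
          by_cases h0 : p - c • g = 0
          · rw [h0, map_zero]
            exact zero_mem _
          refine ih _ ?_ _ ?_ rfl
          · subst hpa
            have hd := m.degree_mem_support h0
            revert hd
            generalize m.degree (p - c • g) = d
            intro hd
            rw [mem_support_iff, coeff_sub, coeff_smul] at hd
            refine lt_of_le_of_ne (not_lt.1 fun hlt' => hd ?_) fun hne => hd ?_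
            · rw [m.coeff_eq_zero_of_lt hlt', m.coeff_eq_zero_of_lt (hg ▸ hlt')]
              simp
            · have hde : d = m.degree p := m.toSyn.injective hne
              have h1 : p.coeff d = m.leadingCoeff p := by rw [hde]; rfl
              have h2 : g.coeff d = m.leadingCoeff g := by rw [hde, ← hg]; rfl
              rw [h1, h2, smul_eq_mul, div_mul_cancel₀ _ hgc, sub_self]
          · exact (totalDegree_sub _ _).trans (max_le hpi ((totalDegree_smul_le _ _).trans hgi))
        have := add_mem hsub (Submodule.smul_mem _ c hgm)
        rwa [map_sub, map_smul, sub_add_cancel] at this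
      by_cases heS : m.degree p ∈ S
      · refine step (monomial (m.degree p) 1) (by simp) ?_ (Submodule.mem_map_of_mem ?_)
        · classical
          rw [m.degree_monomial, if_neg one_ne_zero]
        · exact (monomial_mem_restrictSupport k).2 (Or.inl ⟨heS, hei⟩)
      · simp only [S, Set.mem_ofPred_eq] at heS
        push Not at heS
        obtain ⟨g, hg, hg0, hgd⟩ := heS
        exact step g hg0 hgd (hg ▸ zero_mem _)
  refine ⟨S, ?_, fun i => ?_, ?_⟩
  · intro e e' hle he
    by_contra hc
    obtain ⟨d, rfl⟩ := exists_add_of_le hle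
    exact hup d e' hc he
  · have heq : (restrictTotalDegree σ k i).map φ
        = (restrictSupport k (S ∩ {e | e.degree ≤ i})).map φ := by
      refine le_antisymm ?_ (Submodule.map_mono ?_)
      · rintro _ ⟨p, hp, rfl⟩
        exact hred i _ p ((mem_restrictTotalDegree σ i p).1 hp) rfl
      · rw [restrictTotalDegree_eq_restrictSupport]
        exact restrictSupport_mono _ (Set.inter_subset_inter_left _ (Set.subset_univ _))
    rw [heq, finrank_map_restrictSupport]
    intro p hp hφp
    by_contra hp0
    exact (hp (m.degree_mem_support hp0)).1 p hφp hp0 rfl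
  · intro p hp hp0
    exact ⟨m.degree p, fun h => h p hp hp0 rfl⟩

end LeadingExponents

/-! ### Normally ordered elements of the Weyl algebra -/

section PartialDerivatives

open MvPolynomial

variable {k : Type*} [Field k] {σ : Type*}

theorem MvPolynomial.totalDegree_pderiv_le (s : σ) (p : MvPolynomial σ k) :
    (pderiv s p).totalDegree ≤ p.totalDegree - 1 := by
  refine Finset.sup_le fun m hm => ?_
  rw [mem_support_iff, coeff_pderiv] at hm
  have h : (m + Finsupp.single s 1).degree ≤ p.totalDegree :=
    le_totalDegree (mem_support_iff.2 (left_ne_zero_of_mul hm))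
  rw [map_add, Finsupp.degree_single] at h
  exact Nat.le_sub_of_add_le h

theorem MvPolynomial.totalDegree_pderiv_le_self (s : σ) (p : MvPolynomial σ k) :
    (pderiv s p).totalDegree ≤ p.totalDegree :=
  (totalDegree_pderiv_le s p).trans (Nat.sub_le _ _)

theorem MvPolynomial.eq_C_of_pderiv_eq_zero [CharZero k] {p : MvPolynomial σ k}
    (h : ∀ s, pderiv s p = 0) : p = C (p.coeff 0) := by
  classical
  ext m
  rw [coeff_C]
  split_ifs with hm
  · rw [hm]
  obtain ⟨s, hs⟩ : ∃ s, m s ≠ 0 := by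
    by_contra! hc
    exact hm (Finsupp.ext fun s => (hc s).symm)
  have h1 := coeff_pderiv (i := s) p (m - Finsupp.single s 1)
  rw [h s, coeff_zero, Finsupp.sub_add_single_one_cancel hs] at h1
  exact (mul_eq_zero.1 h1.symm).resolve_right (Nat.cast_add_one_ne_zero _)

theorem MvPolynomial.pderiv_comm (s t : σ) (p : MvPolynomial σ k) :
    pderiv s (pderiv t p) = pderiv t (pderiv s p) := by
  ext m
  simp only [coeff_pderiv, Finsupp.add_apply]
  rw [add_right_comm]
  by_cases hst : s = t
  · rw [hst]
  · simp [Finsupp.single_eq_of_ne hst, Finsupp.single_eq_of_ne (Ne.symm hst)]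
    ring

end PartialDerivatives

namespace WeylAlgebra

open MvPolynomial

variable {k : Type*} [Field k] {n : ℕ}

/-- The Weyl algebra acts on polynomials, with `x_i` acting by multiplication and `∂_i` by
differentiation. In particular it is not zero. -/
noncomputable def polynomialAction (k : Type*) [Field k] (n : ℕ) :
    WeylAlgebra k n →ₐ[k] Module.End k (MvPolynomial (Fin n) k) :=
  lift (fun i => LinearMap.mulLeft k (X i)) (fun i => (pderiv i).toLinearMap)
    (fun i j => LinearMap.ext fun p => mul_left_comm (X i) (X j) p)
    (fun i j => LinearMap.ext fun p => pderiv_comm i j p)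
    (fun i j => by
      refine LinearMap.ext fun p => ?_
      have : pderiv i (X j * p) - X j * pderiv i p = (pderiv i (X j : MvPolynomial (Fin n) k)) * p := by
        rw [pderiv_mul]; ring
      refine this.trans ?_
      split_ifs with h
      · simp [h]
      · simp [pderiv_X_of_ne (Ne.symm h)])

instance instNontrivial : Nontrivial (WeylAlgebra k n) :=
  (polynomialAction k n).toRingHom.domain_nontrivial

/-- The linear map sending the commutative monomial with exponents `(α, β)` to `x^α ∂^β`. -/
noncomputable def normal (k : Type*) [Field k] (n : ℕ) :
    MvPolynomial (Fin n ⊕ Fin n) k →ₗ[k] WeylAlgebra k n :=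
  (basisMonomials _ k).constr k fun e =>
    xPow k (fun i => e (Sum.inl i)) * dPow k (fun i => e (Sum.inr i))

theorem normal_monomial (e : Fin n ⊕ Fin n →₀ ℕ) :
    normal k n (monomial e 1)
      = xPow k (fun i => e (Sum.inl i)) * dPow k (fun i => e (Sum.inr i)) := by
  exact (basisMonomials _ k).constr_basis k _ e

theorem normal_one : normal k n 1 = 1 := by
  have := normal_monomial (k := k) (0 : Fin n ⊕ Fin n →₀ ℕ)
  refine this.trans ?_
  change xPow k 0 * dPow k 0 = 1
  rw [xPow_zero, dPow_zero, one_mul]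

theorem normal_C (c : k) : normal k n (C c) = algebraMap k _ c := by
  rw [C_eq_smul_one, map_smul, normal_one, Algebra.algebraMap_eq_smul_one]

theorem map_normal_restrictTotalDegree (i : ℕ) :
    (restrictTotalDegree (Fin n ⊕ Fin n) k i).map (normal k n) = bernsteinSpan k n i := by
  rw [restrictTotalDegree_eq_restrictSupport, restrictSupport_eq_span, Submodule.map_span,
    bernsteinSpan, ← Set.image_comp]
  congr 1
  ext a
  constructor
  · rintro ⟨e, ⟨-, he⟩, rfl⟩
    refine ⟨_, _, ?_, normal_monomial e⟩
    rwa [Set.mem_ofPred_eq, Finsupp.degree_eq_sum, Fintype.sum_sum_type] at he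
  · rintro ⟨α, β, h, rfl⟩
    refine ⟨Finsupp.equivFunOnFinite.symm (Sum.elim α β), ⟨trivial, ?_⟩, ?_⟩
    · rw [Set.mem_ofPred_eq, Finsupp.degree_eq_sum, Fintype.sum_sum_type]
      simpa using h
    · exact (normal_monomial _).trans (by simp)

theorem normal_mem_bernsteinSpan {p : MvPolynomial (Fin n ⊕ Fin n) k} {i : ℕ}
    (h : p.totalDegree ≤ i) : normal k n p ∈ bernsteinSpan k n i := by
  rw [← map_normal_restrictTotalDegree]
  exact Submodule.mem_map_of_mem ((mem_restrictTotalDegree _ _ _).2 h)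

theorem exists_normal_eq {a : WeylAlgebra k n} {i : ℕ} (ha : a ∈ bernsteinSpan k n i) :
    ∃ p, p.totalDegree ≤ i ∧ normal k n p = a := by
  rw [← map_normal_restrictTotalDegree] at ha
  obtain ⟨p, hp, rfl⟩ := ha
  exact ⟨p, (mem_restrictTotalDegree _ _ _).1 hp, rfl⟩

theorem normal_X_inl_mul (i : Fin n) (p : MvPolynomial (Fin n ⊕ Fin n) k) :
    normal k n (X (Sum.inl i) * p) = x k i * normal k n p := by
  induction p using MvPolynomial.induction_on' with
  | add p q hp hq => rw [mul_add, map_add, map_add, mul_add, hp, hq]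
  | monomial e c =>
    have hc : monomial e c = c • monomial e (1 : k) := by
      rw [smul_monomial, smul_eq_mul, mul_one]
    rw [hc, mul_smul_comm, map_smul, map_smul,
      mul_smul_comm, X, monomial_mul, one_mul, normal_monomial, normal_monomial, ← mul_assoc,
      ← xPow_add_single, add_comm]
    congr 3
    · funext j
      simp [Finsupp.single_apply, Pi.single_apply, eq_comm]
    · funext j
      simp

theorem normal_X_inr_mul (i : Fin n) (p : MvPolynomial (Fin n ⊕ Fin n) k) :
    normal k n (X (Sum.inr i) * p) = normal k n p * d k i := by
  have hcomm : ∀ β : Fin n → ℕ, Commute (d k i) (dPow k β) := fun β => by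
    refine Commute.list_prod_right _ _ fun y hy => ?_
    obtain ⟨j, rfl⟩ := List.mem_ofFn.1 hy
    exact Commute.pow_right (d_comm i j) _
  induction p using MvPolynomial.induction_on' with
  | add p q hp hq => rw [mul_add, map_add, map_add, add_mul, hp, hq]
  | monomial e c =>
    have hc : monomial e c = c • monomial e (1 : k) := by
      rw [smul_monomial, smul_eq_mul, mul_one]
    rw [hc, mul_smul_comm, map_smul, map_smul,
      smul_mul_assoc, X, monomial_mul, one_mul, normal_monomial, normal_monomial, mul_assoc,
      ← (hcomm _).eq, ← dPow_add_single, add_comm]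
    congr 3
    · funext j
      simp
    · funext j
      simp [Finsupp.single_apply, Pi.single_apply, eq_comm]

/-- Moving `∂_i` past `x^α` produces the derivative with respect to `x_i`. -/
theorem d_mul_normal (i : Fin n) (p : MvPolynomial (Fin n ⊕ Fin n) k) :
    d k i * normal k n p = normal k n (X (Sum.inr i) * p + pderiv (Sum.inl i) p) := by
  induction p using MvPolynomial.induction_on with
  | C c =>
    rw [pderiv_C, add_zero, normal_X_inr_mul, normal_C]
    exact (Algebra.commutes c (d k i)).symm
  | add p q hp hq =>
    rw [map_add, mul_add, hp, hq, ← map_add, map_add (pderiv _)]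
    congr 1
    ring
  | mul_X p s hp =>
    rw [mul_comm p]
    cases s with
    | inl j =>
      have h : d k i * x k j = x k j * d k i + (if i = j then 1 else 0) := by
        rw [← d_x]; abel
      rw [normal_X_inl_mul, ← mul_assoc, h, add_mul, mul_assoc, hp, ← normal_X_inl_mul]
      have h2 : (if i = j then (1 : WeylAlgebra k n) else 0) * normal k n p
          = normal k n (pderiv (Sum.inl i) (X (Sum.inl j) : MvPolynomial (Fin n ⊕ Fin n) k) * p) := by
        split_ifs with h
        · simp [h]
        · rw [pderiv_X_of_ne (fun hc => h (Sum.inl.inj hc).symm)]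
          simp
      rw [h2, ← map_add, pderiv_mul]
      congr 1
      ring
    | inr j =>
      rw [normal_X_inr_mul, ← mul_assoc, hp, ← normal_X_inr_mul, pderiv_mul,
        pderiv_X_of_ne (by simp)]
      congr 1
      ring

/-- Moving `x_i` past `∂^β` produces the derivative with respect to the symbol of `∂_i`. -/
theorem normal_mul_x (i : Fin n) (p : MvPolynomial (Fin n ⊕ Fin n) k) :
    normal k n p * x k i = normal k n (X (Sum.inl i) * p + pderiv (Sum.inr i) p) := by
  induction p using MvPolynomial.induction_on with
  | C c =>
    rw [pderiv_C, add_zero, normal_X_inl_mul, normal_C]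
    exact Algebra.commutes c (x k i)
  | add p q hp hq =>
    rw [map_add, add_mul, hp, hq, ← map_add, map_add (pderiv _)]
    congr 1
    ring
  | mul_X p s hp =>
    rw [mul_comm p]
    cases s with
    | inl j =>
      rw [normal_X_inl_mul, mul_assoc, hp, ← normal_X_inl_mul, pderiv_mul,
        pderiv_X_of_ne (by simp)]
      congr 1
      ring
    | inr j =>
      have h : d k j * x k i = x k i * d k j + (if j = i then 1 else 0) := by
        rw [← d_x]; abel
      rw [normal_X_inr_mul, mul_assoc, h, mul_add, ← mul_assoc, hp, ← normal_X_inr_mul]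
      have h2 : normal k n p * (if j = i then (1 : WeylAlgebra k n) else 0)
          = normal k n (pderiv (Sum.inr i) (X (Sum.inr j) : MvPolynomial (Fin n ⊕ Fin n) k) * p) := by
        split_ifs with h
        · simp [h]
        · rw [pderiv_X_of_ne (fun hc => h (Sum.inr.inj hc))]
          simp
      rw [h2, ← map_add, pderiv_mul]
      congr 1
      ring

theorem one_mem_bernsteinSpan (i : ℕ) : (1 : WeylAlgebra k n) ∈ bernsteinSpan k n i :=
  bernsteinSpan_mono (Nat.zero_le i) (bernstein k n).one_mem

theorem x_mem_bernsteinSpan (i : Fin n) : x k i ∈ bernsteinSpan k n 1 := by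
  simpa using x_mul_mem i (one_mem_bernsteinSpan (k := k) 0)

theorem d_mem_bernsteinSpan (i : Fin n) : d k i ∈ bernsteinSpan k n 1 := by
  simpa using d_mul_mem i (one_mem_bernsteinSpan (k := k) 0)

theorem exists_mem_bernsteinSpan (a : WeylAlgebra k n) : ∃ i, a ∈ bernsteinSpan k n i := by
  have ha : a ∈ Algebra.adjoin k (Set.range (x k (n := n)) ∪ Set.range (d k (n := n))) := by
    rw [adjoin_eq_top]; trivial
  induction ha using Algebra.adjoin_induction with
  | mem y hy =>
    rcases hy with ⟨j, rfl⟩ | ⟨j, rfl⟩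
    · exact ⟨1, x_mem_bernsteinSpan j⟩
    · exact ⟨1, d_mem_bernsteinSpan j⟩
  | algebraMap r =>
    rw [Algebra.algebraMap_eq_smul_one]
    exact ⟨0, Submodule.smul_mem _ _ (one_mem_bernsteinSpan 0)⟩
  | add a b _ _ h h' =>
    obtain ⟨i, hi⟩ := h
    obtain ⟨j, hj⟩ := h'
    exact ⟨max i j, add_mem (bernsteinSpan_mono (le_max_left i j) hi)
      (bernsteinSpan_mono (le_max_right i j) hj)⟩
  | mul a b _ _ h h' =>
    obtain ⟨i, hi⟩ := h
    obtain ⟨j, hj⟩ := h'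
    exact ⟨i + j, bernsteinSpan_mul_mem hi hj⟩

theorem normal_surjective : Function.Surjective (normal k n) := fun a =>
  have ⟨_, hi⟩ := exists_mem_bernsteinSpan a
  have ⟨p, _, hp⟩ := exists_normal_eq hi
  ⟨p, hp⟩

end WeylAlgebra

/-! ### The Bernstein inequality -/

section Bernstein

open MvPolynomial WeylAlgebra

variable {k : Type*} [Field k] [CharZero k] {n : ℕ} {M : Type*} [AddCommGroup M] [Module k M]
  [Module (WeylAlgebra k n) M] [IsScalarTower k (WeylAlgebra k n) M]

/-- A nonzero element of `B_i` does not annihilate `B_i • m₀` if `m₀ ≠ 0`: otherwise its commutators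
with the generators, which lie in `B_{i-1}`, annihilate `B_{i-1} • m₀`, hence vanish by induction,
and the element is a scalar. -/
theorem WeylAlgebra.eq_zero_of_normal_smul_eq_zero {m₀ : M} (hm₀ : m₀ ≠ 0) (i : ℕ)
    (p : MvPolynomial (Fin n ⊕ Fin n) k) (hp : p.totalDegree ≤ i)
    (h : ∀ a ∈ bernsteinSpan k n i, normal k n p • a • m₀ = 0) : p = 0 := by
  have hC : ∀ c : k, normal k n (C c) • (1 : WeylAlgebra k n) • m₀ = 0 → c = 0 := fun c hc => by
    rw [normal_C, one_smul, algebraMap_smul] at hc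
    exact (smul_eq_zero.1 hc).resolve_right hm₀
  have hconst : ∀ (i : ℕ) (p : MvPolynomial (Fin n ⊕ Fin n) k),
      (∀ a ∈ bernsteinSpan k n i, normal k n p • a • m₀ = 0) → ∀ c, p = C c → p = 0 := by
    rintro i _ h c rfl
    rw [hC c (h 1 (one_mem_bernsteinSpan i)), C_0]
  induction i generalizing p with
  | zero => exact hconst 0 p h _ (totalDegree_eq_zero_iff_eq_C.1 (Nat.le_zero.1 hp))
  | succ i ih =>
    refine hconst _ p h _ (eq_C_of_pderiv_eq_zero fun s => ?_)
    have hdeg : (pderiv s p).totalDegree ≤ i := (totalDegree_pderiv_le s p).trans (by omega)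
    have hzero : ∀ a ∈ bernsteinSpan k n i, normal k n (pderiv s p) • a • m₀ = 0 := by
      intro a ha
      have ha' := h a (bernsteinSpan_mono (Nat.le_succ i) ha)
      cases s with
      | inl j =>
        have e : normal k n (pderiv (Sum.inl j) p) = d k j * normal k n p - normal k n p * d k j := by
          rw [d_mul_normal, map_add, normal_X_inr_mul, add_sub_cancel_left]
        have h2 := h _ (d_mul_mem j ha)
        rw [mul_smul] at h2
        rw [e, sub_smul, mul_smul, mul_smul, ha', h2, smul_zero, sub_zero]
      | inr j =>
        have e : normal k n (pderiv (Sum.inr j) p) = normal k n p * x k j - x k j * normal k n p := by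
          rw [normal_mul_x, map_add, normal_X_inl_mul, add_sub_cancel_left]
        have h2 := h _ (x_mul_mem j ha)
        rw [mul_smul] at h2
        rw [e, sub_smul, mul_smul, mul_smul, ha', h2, smul_zero, sub_zero]
    exact ih _ hdeg hzero

/-- The monomials `x^α ∂^β` are linearly independent. -/
theorem WeylAlgebra.normal_injective : Function.Injective (normal k n) := by
  rw [injective_iff_map_eq_zero]
  intro p hp
  refine eq_zero_of_normal_smul_eq_zero (M := WeylAlgebra k n) (m₀ := 1) one_ne_zero _ p le_rfl ?_
  intro a _
  rw [hp, zero_smul]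

end Bernstein

/-! ### Hilbert polynomials of cyclic modules -/

section Growth

open Polynomial Filter

theorem Polynomial.degree_le_of_eventually_eval_le {p q : ℚ[X]}
    (h0 : ∀ᶠ i : ℕ in atTop, 0 ≤ p.eval (i : ℚ))
    (h : ∀ᶠ i : ℕ in atTop, p.eval (i : ℚ) ≤ q.eval (i : ℚ)) : p.degree ≤ q.degree := by
  by_contra! hlt
  have hp : p ≠ 0 := ne_zero_of_degree_gt hlt
  have hlim := (div_tendsto_atTop_zero_of_degree_lt q p hlt).comp
    (tendsto_natCast_atTop_atTop (R := ℚ))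
  have hroot := (tendsto_natCast_atTop_atTop (R := ℚ)).eventually (eventually_atTop_not_isRoot p hp)
  obtain ⟨i, h1, h2, h3, h4⟩ :=
    (h0.and (h.and (hroot.and (hlim.eventually (gt_mem_nhds one_pos))))).exists
  have hpos : 0 < p.eval (i : ℚ) := lt_of_le_of_ne h1 (Ne.symm h3)
  rw [Function.comp_apply, div_lt_one hpos] at h4
  exact absurd h2 (not_le.2 h4)

theorem Polynomial.natDegree_comp_linear_le (p : ℚ[X]) (a b : ℚ) :
    (p.comp (C a * X + C b)).natDegree ≤ p.natDegree := by
  refine natDegree_comp_le.trans ?_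
  exact (Nat.mul_le_mul_left _ natDegree_linear_le).trans_eq (mul_one _)

theorem Polynomial.degree_preHilbertPoly (d e : ℕ) : (preHilbertPoly ℚ d e).degree = d := by
  have h0 : preHilbertPoly ℚ d e ≠ 0 := by
    rw [← leadingCoeff_ne_zero, leadingCoeff_preHilbertPoly]
    positivity
  rw [degree_eq_natDegree h0, natDegree_preHilbertPoly]

end Growth

section Cyclic

open WeylAlgebra MvPolynomial

variable {k : Type*} [Field k] {n : ℕ} {M : Type*} [AddCommGroup M] [Module k M]
  [Module (WeylAlgebra k n) M] [IsScalarTower k (WeylAlgebra k n) M]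

instance MvPolynomial.finiteDimensional_restrictTotalDegree {σ : Type*} [Finite σ] (i : ℕ) :
    FiniteDimensional k (restrictTotalDegree σ k i) := by
  have : Finite ((Set.univ : Set (σ →₀ ℕ)) ∩ {e | e.degree ≤ i} : Set _) :=
    finite_degree_le Set.univ i
  rw [restrictTotalDegree_eq_restrictSupport]
  exact Module.Finite.of_basis (basisRestrictSupport k _)

instance WeylAlgebra.finiteDimensional_bernsteinSpan (i : ℕ) :
    FiniteDimensional k (bernsteinSpan k n i) := by
  rw [← map_normal_restrictTotalDegree]
  infer_instance

theorem WeylAlgebra.finrank_bernsteinSpan [CharZero k] (i : ℕ) :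
    Module.finrank k (bernsteinSpan k n i) = (i + (n + n)).choose (n + n) := by
  rw [← map_normal_restrictTotalDegree, restrictTotalDegree_eq_restrictSupport,
    finrank_map_restrictSupport _ _ _
      fun p _ hp => normal_injective (hp.trans (map_zero _).symm), degreeCount_univ]
  simp

/-- The subspace `B_i • m₀`. -/
noncomputable def cyclicStep (k : Type*) [Field k] {n : ℕ} {M : Type*} [AddCommGroup M] [Module k M]
    [Module (WeylAlgebra k n) M] [IsScalarTower k (WeylAlgebra k n) M] (m₀ : M) (i : ℕ) :
    Submodule k M :=
  (bernsteinSpan k n i).map ((LinearMap.toSpanSingleton (WeylAlgebra k n) M m₀).restrictScalars k)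

instance finiteDimensional_cyclicStep (m₀ : M) (i : ℕ) :
    FiniteDimensional k (cyclicStep k (n := n) m₀ i) := by
  unfold cyclicStep
  infer_instance

theorem smul_mem_cyclicStep {m₀ m : M} {i j : ℕ} {a : WeylAlgebra k n}
    (ha : a ∈ bernsteinSpan k n i) (hm : m ∈ cyclicStep k (n := n) m₀ j) :
    a • m ∈ cyclicStep k (n := n) m₀ (i + j) := by
  obtain ⟨b, hb, rfl⟩ := hm
  exact ⟨a * b, bernsteinSpan_mul_mem ha hb, mul_smul a b m₀⟩

/-- The multiplication `B_i → Hom(B_i m₀, B_{2i} m₀)`. -/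
noncomputable def cyclicStepMul (k : Type*) [Field k] {n : ℕ} {M : Type*} [AddCommGroup M]
    [Module k M] [Module (WeylAlgebra k n) M] [IsScalarTower k (WeylAlgebra k n) M] (m₀ : M)
    (i : ℕ) : bernsteinSpan k n i →ₗ[k]
      (cyclicStep k (n := n) m₀ i →ₗ[k] cyclicStep k (n := n) m₀ (i + i)) :=
  LinearMap.mk₂ k (fun a m => ⟨(a : WeylAlgebra k n) • (m : M), smul_mem_cyclicStep a.2 m.2⟩)
    (fun _ _ _ => Subtype.ext (add_smul _ _ _))
    (fun _ _ _ => Subtype.ext (smul_assoc _ _ _))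
    (fun _ _ _ => Subtype.ext (smul_add _ _ _))
    (fun c a m => Subtype.ext (smul_comm (a : WeylAlgebra k n) c (m : M)))

theorem cyclicStepMul_injective [CharZero k] {m₀ : M} (hm₀ : m₀ ≠ 0) (i : ℕ) :
    Function.Injective (cyclicStepMul k (n := n) m₀ i) := by
  rw [injective_iff_map_eq_zero]
  rintro ⟨a, ha⟩ h
  obtain ⟨p, hp, rfl⟩ := exists_normal_eq ha
  have : p = 0 := eq_zero_of_normal_smul_eq_zero hm₀ i p hp fun b hb =>
    congrArg Subtype.val (DFunLike.congr_fun h (⟨b • m₀, b, hb, rfl⟩ : cyclicStep k (n := n) m₀ i))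
  simp [this]

/-- The annihilator of `m₀` is a left ideal, and left multiplication by `x_i` and `∂_i` is
multiplication by a variable up to a derivative, so leading exponents apply. -/
theorem eventuallyPolynomial_finrank_cyclicStep (m₀ : M) :
    EventuallyPolynomial fun i => Module.finrank k (cyclicStep k (n := n) m₀ i) := by
  obtain ⟨S, hS, hrank, -⟩ := exists_isLowerSet_finrank_map_eq
    (((LinearMap.toSpanSingleton (WeylAlgebra k n) M m₀).restrictScalars k).comp (normal k n))
    (by
      intro s p hp
      have hp' : normal k n p • m₀ = 0 := hp
      cases s with
      | inl i =>
        refine ⟨0, by simp, ?_⟩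
        change normal k n _ • m₀ = 0
        rw [add_zero, normal_X_inl_mul, mul_smul, hp', smul_zero]
      | inr i =>
        refine ⟨pderiv (Sum.inl i) p, totalDegree_pderiv_le_self _ _, ?_⟩
        change normal k n _ • m₀ = 0
        rw [← d_mul_normal, mul_smul, hp', smul_zero])
  convert! eventuallyPolynomial_degreeCount hS using 2 with i
  rw [← hrank i, cyclicStep, ← map_normal_restrictTotalDegree, Submodule.map_comp]

/-- **Bernstein's inequality.** The Hilbert polynomial of a nonzero cyclic module over `A_n(k)` has
degree at least `n`, because `B_i` embeds into `Hom(B_i m₀, B_{2i} m₀)` and has dimension of order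
`i ^ (2n)`. -/
theorem exists_polynomial_finrank_cyclicStep [CharZero k] {m₀ : M} (hm₀ : m₀ ≠ 0) :
    ∃ p : Polynomial ℚ, (n : WithBot ℕ) ≤ p.degree ∧
      ∀ᶠ i : ℕ in Filter.atTop,
        (Module.finrank k (cyclicStep k (n := n) m₀ i) : ℚ) = p.eval (i : ℚ) := by
  obtain ⟨p, hp⟩ := eventuallyPolynomial_finrank_cyclicStep (k := k) (n := n) m₀
  refine ⟨p, ?_, hp⟩
  let q : Polynomial ℚ := p * p.comp (Polynomial.C 2 * Polynomial.X + Polynomial.C 0)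
  have hle : (Polynomial.preHilbertPoly ℚ (n + n) 0).degree ≤ q.degree := by
    have htwo : Filter.Tendsto (fun i : ℕ => i + i) Filter.atTop Filter.atTop :=
      Filter.tendsto_atTop_mono (fun i => Nat.le_add_left i i) Filter.tendsto_id
    have hev : ∀ i : ℕ, (Polynomial.preHilbertPoly ℚ (n + n) 0).eval (i : ℚ)
        = Module.finrank k (bernsteinSpan k n i) := fun i => by
      rw [Polynomial.preHilbertPoly_eq_choose_sub_add ℚ _ (Nat.zero_le i), finrank_bernsteinSpan,
        Nat.sub_zero]
    refine Polynomial.degree_le_of_eventually_eval_le (Filter.Eventually.of_forall fun i => ?_) ?_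
    · rw [hev]
      exact Nat.cast_nonneg _
    · filter_upwards [hp, htwo.eventually hp] with i h1 h2
      have h3 := LinearMap.finrank_le_finrank_of_injective
        (cyclicStepMul_injective (k := k) (n := n) hm₀ i)
      rw [Module.finrank_linearMap] at h3
      have h4 : q.eval (i : ℚ) = p.eval (i : ℚ) * p.eval ((i + i : ℕ) : ℚ) := by
        simp [q, two_mul]
      rw [hev, h4, ← h1, ← h2]
      exact_mod_cast h3
  rw [Polynomial.degree_preHilbertPoly] at hle
  have hp0 : p ≠ 0 := by
    rintro rfl
    simp [q] at hle
  have hq : q.degree ≤ ((p.natDegree + p.natDegree : ℕ) : WithBot ℕ) :=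
    Polynomial.degree_le_of_natDegree_le (Polynomial.natDegree_mul_le.trans
      (Nat.add_le_add_left (Polynomial.natDegree_comp_linear_le _ _ _) _))
  have h5 : n + n ≤ p.natDegree + p.natDegree := by exact_mod_cast hle.trans hq
  rw [Polynomial.degree_eq_natDegree hp0]
  exact_mod_cast (show n ≤ p.natDegree by omega)

/-- The filtration `B_i • m₀` of a module generated by `m₀`. -/
noncomputable def cyclicFiltration (m₀ : M) (h : ∀ m : M, ∃ a : WeylAlgebra k n, a • m₀ = m) :
    ModuleFiltration (bernstein k n) M where
  step := cyclicStep k (n := n) m₀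
  mono _ _ hij := Submodule.map_mono (bernsteinSpan_mono hij)
  finiteDimensional i := finiteDimensional_cyclicStep m₀ i
  exhaustive m := by
    obtain ⟨a, rfl⟩ := h m
    obtain ⟨i, hi⟩ := exists_mem_bernsteinSpan a
    exact ⟨i, a, hi, rfl⟩
  smul_mem _ _ _ ha _ hm := smul_mem_cyclicStep ha hm

/-- The associated graded module is generated by the symbol of `m₀` in degree `0`. -/
theorem isGood_cyclicFiltration (m₀ : M) (h : ∀ m : M, ∃ a : WeylAlgebra k n, a • m₀ = m) :
    (cyclicFiltration m₀ h).IsGood := by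
  let Γ := cyclicFiltration m₀ h
  have h0 : m₀ ∈ Γ.step 0 := ⟨1, one_mem_bernsteinSpan 0, one_smul _ m₀⟩
  let g : ⨁ i, Γ.Piece i := DirectSum.of Γ.Piece 0 (Γ.symbol 0 ⟨m₀, h0⟩)
  refine ⟨⟨{g}, ?_⟩⟩
  rw [eq_top_iff]
  intro y _
  induction y using DirectSum.induction_on with
  | zero => exact zero_mem _
  | add y z hy hz => exact add_mem (hy trivial) (hz trivial)
  | of i y =>
    obtain ⟨⟨_, a, ha, rfl⟩, rfl⟩ := GrPiece.symbol_surjective Γ.step i y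
    have e := Γ.of_symbol_smul i 0 ⟨a, ha⟩ ⟨m₀, h0⟩
    have hg : g ∈ Submodule.span (⨁ i, (bernstein k n).Piece i)
        (({g} : Finset (⨁ i, Γ.Piece i)) : Set (⨁ i, Γ.Piece i)) :=
      Submodule.subset_span (by simp)
    exact e ▸ Submodule.smul_mem _
      (DirectSum.of (bernstein k n).Piece i ((bernstein k n).symbol i ⟨a, ha⟩)) hg

end Cyclic

/-! ### A criterion for simplicity and holonomicity -/

section Criterion

open WeylAlgebra MvPolynomial

variable {k : Type*} [Field k] {n : ℕ} {M : Type*} [AddCommGroup M] [Module k M]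
  [Module (WeylAlgebra k n) M]

theorem WeylAlgebra.prod_smul_mem {Γ : ℕ → Submodule k M} {d : ℕ} {g : Fin n → WeylAlgebra k n}
    {w : (Fin n → ℕ) → WeylAlgebra k n} (hw0 : w 0 = 1)
    (hw : ∀ i γ, w (γ + Pi.single i 1) = g i * w γ)
    (hg : ∀ i j, ∀ m ∈ Γ j, g i • m ∈ Γ (j + d)) {j : ℕ} {m : M} (hm : m ∈ Γ j) (l : ℕ)
    (α : Fin n → ℕ) (hα : ∑ s, α s = l) : w α • m ∈ Γ (j + d * l) := by
  induction l generalizing α with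
  | zero =>
    obtain rfl : α = 0 := funext fun s => (Finset.sum_eq_zero_iff.1 hα) s (Finset.mem_univ s)
    simpa [hw0] using hm
  | succ l ih =>
    obtain ⟨s, γ, rfl, hγ⟩ := exists_single_add hα
    rw [hw, mul_smul, mul_add_one, ← add_assoc]
    exact hg s _ _ (ih γ hγ)

variable [IsScalarTower k (WeylAlgebra k n) M]

theorem WeylAlgebra.smul_mem_of_generators {Γ : ℕ → Submodule k M} (hΓ : Monotone Γ) {d : ℕ}
    (hx : ∀ i j, ∀ m ∈ Γ j, x k (n := n) i • m ∈ Γ (j + d))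
    (hd : ∀ i j, ∀ m ∈ Γ j, WeylAlgebra.d k (n := n) i • m ∈ Γ (j + d)) {i j : ℕ}
    {a : WeylAlgebra k n} (ha : a ∈ bernsteinSpan k n i) {m : M} (hm : m ∈ Γ j) :
    a • m ∈ Γ (j + d * i) := by
  induction ha using Submodule.span_induction with
  | mem a h =>
    obtain ⟨α, β, h, rfl⟩ := h
    rw [mul_smul]
    refine hΓ ?_ (prod_smul_mem xPow_zero xPow_add_single hx
      (prod_smul_mem dPow_zero dPow_add_single hd hm _ β rfl) _ α rfl)
    rw [add_assoc, ← mul_add, add_comm (∑ s, β s)]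
    exact Nat.add_le_add_left (Nat.mul_le_mul_left d h) j
  | zero => simp
  | add a b _ _ h h' => rw [add_smul]; exact add_mem h h'
  | smul r a _ h => rw [smul_assoc]; exact Submodule.smul_mem _ r h

/-- A polynomial coordinate system `ψ` on an `A_n(k)`-module in which the generators of `A_n(k)`
raise degrees by at most `d`, while multiplication by each variable is, up to terms of lower degree,
the action of an element of `A_n(k)`. -/
structure IsPolynomialChart (k : Type*) [Field k] (n : ℕ) {M : Type*} [AddCommGroup M] [Module k M]
    [Module (WeylAlgebra k n) M] {σ : Type*} (ψ : MvPolynomial σ k ≃ₗ[k] M) (d : ℕ) : Prop where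
  x_smul : ∀ i p, ∃ q : MvPolynomial σ k, q.totalDegree ≤ p.totalDegree + d ∧
    x k (n := n) i • ψ p = ψ q
  d_smul : ∀ i p, ∃ q : MvPolynomial σ k, q.totalDegree ≤ p.totalDegree + d ∧
    WeylAlgebra.d k (n := n) i • ψ p = ψ q
  exists_smul_eq : ∀ s, ∃ a : WeylAlgebra k n, ∀ p, ∃ r : MvPolynomial σ k,
    r.totalDegree ≤ p.totalDegree ∧ a • ψ p = ψ (X s * p + r)

namespace IsPolynomialChart

variable {σ : Type*} {ψ : MvPolynomial σ k ≃ₗ[k] M} {d : ℕ}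

/-- Elements of `B_i` raise degrees by at most `d * i`. -/
theorem exists_smul_eq_of_mem (h : IsPolynomialChart k n ψ d) {i c : ℕ} {a : WeylAlgebra k n}
    (ha : a ∈ bernsteinSpan k n i) {p : MvPolynomial σ k} (hp : p.totalDegree ≤ c) :
    ∃ q : MvPolynomial σ k, q ∈ restrictTotalDegree σ k (c + d * i) ∧ ψ q = a • ψ p := by
  have hgen : ∀ g : WeylAlgebra k n, (∀ p, ∃ q : MvPolynomial σ k,
      q.totalDegree ≤ p.totalDegree + d ∧ g • ψ p = ψ q) → ∀ j,
      ∀ m ∈ (restrictTotalDegree σ k j).map ψ.toLinearMap,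
        g • m ∈ (restrictTotalDegree σ k (j + d)).map ψ.toLinearMap := by
    rintro g hg j _ ⟨p, hp, rfl⟩
    obtain ⟨q, hq, hq'⟩ := hg p
    exact ⟨q, (mem_restrictTotalDegree _ _ _).2 (hq.trans
      (Nat.add_le_add_right ((mem_restrictTotalDegree _ _ _).1 hp) d)), hq'.symm⟩
  exact smul_mem_of_generators
    (Γ := fun j => (restrictTotalDegree σ k j).map ψ.toLinearMap)
    (fun i j hij => Submodule.map_mono fun p hp =>
      (mem_restrictTotalDegree _ _ _).2 (((mem_restrictTotalDegree _ _ _).1 hp).trans hij))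
    (fun i => hgen _ (h.x_smul i)) (fun i => hgen _ (h.d_smul i)) ha
    ⟨p, (mem_restrictTotalDegree _ _ _).2 hp, rfl⟩

variable [Finite σ]

/-- The leading exponents of a submodule control the degree filtration of the quotient. -/
theorem exists_isLowerSet (h : IsPolynomialChart k n ψ d) (I : Submodule (WeylAlgebra k n) M) :
    ∃ S : Set (σ →₀ ℕ), IsLowerSet S ∧
      (∀ i, Module.finrank k ((restrictTotalDegree σ k i).map
        ((I.mkQ.restrictScalars k).comp ψ.toLinearMap)) = degreeCount S i) ∧
      (I ≠ ⊥ → ∃ e, e ∉ S) := by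
  obtain ⟨S, hS, hrank, hne⟩ := exists_isLowerSet_finrank_map_eq
    ((I.mkQ.restrictScalars k).comp ψ.toLinearMap) (by
      intro s p hp
      have hp' : ψ p ∈ I := (Submodule.Quotient.mk_eq_zero I).1 hp
      obtain ⟨a, ha⟩ := h.exists_smul_eq s
      obtain ⟨r, hr, har⟩ := ha p
      exact ⟨r, hr, (Submodule.Quotient.mk_eq_zero I).2 (har ▸ I.smul_mem a hp')⟩)
  refine ⟨S, hS, hrank, fun hI => ?_⟩
  obtain ⟨m, hm, hm0⟩ := I.ne_bot_iff.1 hI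
  refine hne (ψ.symm m) ?_ (by simpa using hm0)
  refine (Submodule.Quotient.mk_eq_zero I).2 ?_
  simpa using hm

/-- The quotient by a proper nonzero submodule would have a Hilbert polynomial of degree less than
`n`, which contradicts Bernstein's inequality. -/
theorem isSimpleModule [CharZero k] (h : IsPolynomialChart k n ψ d) (hσ : Nat.card σ = n) :
    IsSimpleModule (WeylAlgebra k n) M := by
  have : Nontrivial M := ψ.symm.toEquiv.nontrivial
  refine { eq_bot_or_eq_top := fun I => ?_, toNontrivial := inferInstance }
  by_contra! hI
  obtain ⟨S, hS, hrank, hne⟩ := h.exists_isLowerSet I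
  obtain ⟨e, he⟩ := hne hI.1
  obtain ⟨m, hm⟩ : ∃ m, m ∉ I := by
    by_contra! hc
    exact hI.2 (eq_top_iff.2 fun m _ => hc m)
  have hm0 : I.mkQ (ψ (ψ.symm m)) ≠ 0 := by
    rw [ψ.apply_symm_apply]
    exact fun hc => hm ((Submodule.Quotient.mk_eq_zero I).1 hc)
  obtain ⟨P, hP, hPev⟩ := exists_polynomial_finrank_cyclicStep (k := k) (n := n) hm0
  let c := max (ψ.symm m).totalDegree e.degree
  -- The difference of the counting polynomials of `ℕ^σ` and of `e + ℕ^σ` has degree less than `n`.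
  let Q : Polynomial ℚ := Polynomial.preHilbertPoly ℚ n 0 - Polynomial.preHilbertPoly ℚ n e.degree
  let L : Polynomial ℚ := Polynomial.C (d : ℚ) * Polynomial.X + Polynomial.C (c : ℚ)
  have hQ : Q.degree < n := by
    rw [← Polynomial.degree_preHilbertPoly n 0]
    refine Polynomial.degree_sub_lt_left ?_ ?_ ?_
    · rw [Polynomial.degree_preHilbertPoly, Polynomial.degree_preHilbertPoly]
    · rw [← Polynomial.leadingCoeff_ne_zero, Polynomial.leadingCoeff_preHilbertPoly]
      positivity
    · rw [Polynomial.leadingCoeff_preHilbertPoly, Polynomial.leadingCoeff_preHilbertPoly]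
  have hQL : (Q.comp L).degree < n := by
    by_cases hQ0 : Q = 0
    · simp [hQ0]
    · refine lt_of_le_of_lt (Polynomial.degree_le_of_natDegree_le
        (Polynomial.natDegree_comp_linear_le Q _ _)) ?_
      rwa [← Polynomial.degree_eq_natDegree hQ0]
  refine absurd (hP.trans (Polynomial.degree_le_of_eventually_eval_le ?_ ?_)) (not_le.2 hQL)
  · filter_upwards [hPev] with i hi
    rw [← hi]
    exact Nat.cast_nonneg _
  · filter_upwards [hPev] with i hi
    have hc : e.degree ≤ c + d * i := (le_max_right _ _).trans (Nat.le_add_right _ _)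
    have h1 : Module.finrank k (cyclicStep k (n := n) (I.mkQ (ψ (ψ.symm m))) i)
        ≤ degreeCount S (c + d * i) := by
      rw [← hrank]
      refine Submodule.finrank_mono ?_
      rintro _ ⟨a, ha, rfl⟩
      obtain ⟨q, hq, hq'⟩ := h.exists_smul_eq_of_mem ha (le_max_left _ _ : _ ≤ c)
      exact ⟨q, hq, congrArg I.mkQ hq'⟩
    have h2 := degreeCount_add_le hS he (c + d * i - e.degree)
    rw [Nat.sub_add_cancel hc, degreeCount_univ, degreeCount_univ, hσ] at h2
    have h3 : (Q.comp L).eval (i : ℚ) = ((c + d * i + n).choose n : ℚ)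
        - ((c + d * i - e.degree + n).choose n : ℚ) := by
      have h4 : L.eval (i : ℚ) = ((c + d * i : ℕ) : ℚ) := by
        simp [L, add_comm]
      rw [Polynomial.eval_comp, h4, Polynomial.eval_sub,
        Polynomial.preHilbertPoly_eq_choose_sub_add ℚ _ (Nat.zero_le _),
        Polynomial.preHilbertPoly_eq_choose_sub_add ℚ _ hc, Nat.sub_zero]
    rw [← hi, h3, le_sub_iff_add_le]
    exact_mod_cast (Nat.add_le_add_right h1 _).trans h2

/-- The module is cyclic, as it is simple, and the degree filtration bounds the degree of the
Hilbert polynomial by `n`. Bernstein's inequality is the opposite bound. -/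
theorem isHolonomic [CharZero k] (h : IsPolynomialChart k n ψ d) (hσ : Nat.card σ = n) :
    IsHolonomic k n M := by
  have := h.isSimpleModule hσ
  refine ⟨inferInstance, Or.inr ?_⟩
  have h1 : ψ 1 ≠ 0 := by simp
  have hgen := IsSimpleModule.toSpanSingleton_surjective (WeylAlgebra k n) h1
  obtain ⟨P, hP, hPev⟩ := exists_polynomial_finrank_cyclicStep (k := k) (n := n) h1
  refine ⟨cyclicFiltration (ψ 1) hgen, isGood_cyclicFiltration _ _, P, le_antisymm ?_ hP, hPev⟩
  let L : Polynomial ℚ := Polynomial.C (d : ℚ) * Polynomial.X + Polynomial.C 0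
  have hL : ((Polynomial.preHilbertPoly ℚ n 0).comp L).degree ≤ n :=
    Polynomial.degree_le_of_natDegree_le ((Polynomial.natDegree_comp_linear_le _ _ _).trans_eq
      (Polynomial.natDegree_preHilbertPoly ℚ n 0))
  refine le_trans (Polynomial.degree_le_of_eventually_eval_le ?_ ?_) hL
  · filter_upwards [hPev] with i hi
    rw [← hi]
    exact Nat.cast_nonneg _
  · filter_upwards [hPev] with i hi
    have h2 : cyclicStep k (n := n) (ψ 1) i
        ≤ (restrictTotalDegree σ k (d * i)).map ψ.toLinearMap := by
      rintro _ ⟨a, ha, rfl⟩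
      obtain ⟨q, hq, hq'⟩ := h.exists_smul_eq_of_mem ha (p := 1) (c := 0) (by simp)
      exact ⟨q, by rwa [zero_add] at hq, hq'⟩
    have h3 := Submodule.finrank_mono h2
    have h4 : Module.finrank k ((restrictTotalDegree σ k (d * i)).map ψ.toLinearMap)
        = (d * i + n).choose n := by
      rw [restrictTotalDegree_eq_restrictSupport, finrank_map_restrictSupport _ _ _
        fun p _ hp => by simpa using hp, degreeCount_univ, hσ]
    have h5 : L.eval (i : ℚ) = ((d * i : ℕ) : ℚ) := by
      simp [L]
    rw [← hi, Polynomial.eval_comp, h5,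
      Polynomial.preHilbertPoly_eq_choose_sub_add ℚ _ (Nat.zero_le _), Nat.sub_zero, ← h4]
    exact_mod_cast h3

end IsPolynomialChart

end Criterion

/-! ### Graphs of endomorphisms -/

namespace WeylAlgebra

open MvPolynomial

variable {k : Type*} [Field k] {n : ℕ}

theorem envelopingEquiv_symm_x_castAdd (i : Fin n) :
    (envelopingEquiv k n).symm (x k (Fin.castAdd n i)) = x k i ⊗ₜ 1 := by
  rw [AlgEquiv.symm_apply_eq]
  simp [envelopingEquiv, doubleEquiv, doubleHom, inclLeft, lift_x]

theorem envelopingEquiv_symm_d_castAdd (i : Fin n) :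
    (envelopingEquiv k n).symm (d k (Fin.castAdd n i)) = d k i ⊗ₜ 1 := by
  rw [AlgEquiv.symm_apply_eq]
  simp [envelopingEquiv, doubleEquiv, doubleHom, inclLeft, lift_d]

theorem transpose_x (i : Fin n) : transpose k n (x k i) = MulOpposite.op (x k i) :=
  lift_x _ _ _ _ _ i

theorem transpose_d (i : Fin n) : transpose k n (d k i) = MulOpposite.op (-d k i) :=
  lift_d _ _ _ _ _ i

theorem envelopingEquiv_symm_x_natAdd (i : Fin n) :
    (envelopingEquiv k n).symm (x k (Fin.natAdd n i)) = 1 ⊗ₜ MulOpposite.op (x k i) := by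
  rw [AlgEquiv.symm_apply_eq, ← transpose_x]
  simp [envelopingEquiv, doubleEquiv, doubleHom, inclRight, lift_x, -Fin.natAdd_eq_addNat]

theorem envelopingEquiv_symm_d_natAdd (i : Fin n) :
    (envelopingEquiv k n).symm (d k (Fin.natAdd n i)) = 1 ⊗ₜ MulOpposite.op (-d k i) := by
  rw [AlgEquiv.symm_apply_eq, ← transpose_d]
  simp [envelopingEquiv, doubleEquiv, doubleHom, inclRight, lift_d, -Fin.natAdd_eq_addNat]

section Bimodule

variable (k n) (M : Type*) [AddCommGroup M] [Module k M]
  [Module (WeylAlgebra k n) M] [Module (WeylAlgebra k n)ᵐᵒᵖ M]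
  [IsScalarTower k (WeylAlgebra k n) M] [IsScalarTower k (WeylAlgebra k n)ᵐᵒᵖ M]
  [SMulCommClass (WeylAlgebra k n) (WeylAlgebra k n)ᵐᵒᵖ M]

variable {M} in
theorem doubleModule_smul_of_symm_eq {w : WeylAlgebra k (n + n)} {a : WeylAlgebra k n}
    {b : (WeylAlgebra k n)ᵐᵒᵖ} (h : (envelopingEquiv k n).symm w = a ⊗ₜ b) (m : M) :
    letI := doubleModule k n M
    w • m = a • b • m := by
  let := envelopingModule k (WeylAlgebra k n) M
  change (envelopingEquiv k n).symm w • m = a • b • m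
  rw [h]
  rfl

theorem isSimpleBimodule_of_isSimpleModule
    (h : letI := doubleModule k n M; IsSimpleModule (WeylAlgebra k (n + n)) M) :
    IsSimpleBimodule k (WeylAlgebra k n) M := by
  let := envelopingModule k (WeylAlgebra k n) M
  let := doubleModule k n M
  have h' : IsSimpleModule (WeylAlgebra k (n + n)) M := h
  have : Nontrivial M := IsSimpleModule.nontrivial (WeylAlgebra k (n + n)) M
  refine { eq_bot_or_eq_top := fun I => ?_, toNontrivial := inferInstance }
  let J : Submodule (WeylAlgebra k (n + n)) M :=
    { I with smul_mem' := fun w m hm => I.smul_mem ((envelopingEquiv k n).symm w) hm }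
  refine (eq_bot_or_eq_top J).imp (fun hJ => ?_) fun hJ => ?_
  · exact SetLike.ext fun m => SetLike.ext_iff.1 hJ m
  · exact SetLike.ext fun m => SetLike.ext_iff.1 hJ m

variable [CharZero k]

/-- A bimodule with a polynomial chart, in `2n` variables, is holonomic and simple. -/
theorem isHolonomicBimodule_and_isSimpleBimodule
    (ψ : MvPolynomial (Fin n ⊕ Fin n) k ≃ₗ[k] M) {d : ℕ}
    (h : letI := doubleModule k n M; IsPolynomialChart k (n + n) ψ d) :
    IsHolonomicBimodule k n M ∧ IsSimpleBimodule k (WeylAlgebra k n) M := by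
  let := doubleModule k n M
  have := doubleModule_isScalarTower k n M
  have h' : IsPolynomialChart k (n + n) ψ d := h
  have hσ : Nat.card (Fin n ⊕ Fin n) = n + n := by simp
  exact ⟨h'.isHolonomic hσ, isSimpleBimodule_of_isSimpleModule k n M (h'.isSimpleModule hσ)⟩

end Bimodule

theorem exists_mul_normal_eq {d : ℕ} {c : WeylAlgebra k n} (hc : c ∈ bernsteinSpan k n d)
    (p : MvPolynomial (Fin n ⊕ Fin n) k) :
    ∃ q, q.totalDegree ≤ p.totalDegree + d ∧ c * normal k n p = normal k n q :=
  have ⟨q, hq, hq'⟩ := exists_normal_eq (bernsteinSpan_mul_mem hc (normal_mem_bernsteinSpan le_rfl))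
  ⟨q, by rwa [add_comm], hq'.symm⟩

theorem exists_normal_mul_eq {d : ℕ} {c : WeylAlgebra k n} (hc : c ∈ bernsteinSpan k n d)
    (p : MvPolynomial (Fin n ⊕ Fin n) k) :
    ∃ q, q.totalDegree ≤ p.totalDegree + d ∧ normal k n p * c = normal k n q :=
  have ⟨q, hq, hq'⟩ := exists_normal_eq (bernsteinSpan_mul_mem (normal_mem_bernsteinSpan le_rfl) hc)
  ⟨q, hq, hq'.symm⟩

/-- A common degree bound for the images of the generators. -/
theorem exists_degree_bound (f : WeylAlgebra k n →ₐ[k] WeylAlgebra k n) :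
    ∃ d, 1 ≤ d ∧ (∀ i, f (x k i) ∈ bernsteinSpan k n d) ∧
      ∀ i, f (WeylAlgebra.d k i) ∈ bernsteinSpan k n d := by
  choose u hu using fun i => exists_mem_bernsteinSpan (f (x k i))
  choose v hv using fun i => exists_mem_bernsteinSpan (f (WeylAlgebra.d k i))
  refine ⟨1 + ∑ i, u i + ∑ i, v i, by omega, fun i => bernsteinSpan_mono ?_ (hu i),
    fun i => bernsteinSpan_mono ?_ (hv i)⟩
  · have := Finset.single_le_sum (fun j _ => Nat.zero_le (u j)) (Finset.mem_univ i)
    omega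
  · have := Finset.single_le_sum (fun j _ => Nat.zero_le (v j)) (Finset.mem_univ i)
    omega

variable [CharZero k]

/-- Normal ordering as an isomorphism, in characteristic zero. -/
noncomputable def normalEquiv (k : Type*) [Field k] [CharZero k] (n : ℕ) :
    MvPolynomial (Fin n ⊕ Fin n) k ≃ₗ[k] WeylAlgebra k n :=
  LinearEquiv.ofBijective (normal k n) ⟨normal_injective, normal_surjective⟩

/-- Left multiplication supplies the elements of `A_{2n}(k)` that act on the graph as the variables
do, up to terms of lower degree. -/
theorem isPolynomialChart_endGraph (f : WeylAlgebra k n →ₐ[k] WeylAlgebra k n) {d : ℕ} (hd : 1 ≤ d)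
    (hx : ∀ i, f (x k i) ∈ bernsteinSpan k n d)
    (hd' : ∀ i, f (WeylAlgebra.d k i) ∈ bernsteinSpan k n d) :
    letI := doubleModule k n (EndGraph f)
    IsPolynomialChart k (n + n) ((normalEquiv k n).trans (EndGraph.of f)) d := by
  let := doubleModule k n (EndGraph f)
  have hl : ∀ {w : WeylAlgebra k (n + n)} {a : WeylAlgebra k n},
      (envelopingEquiv k n).symm w = a ⊗ₜ 1 → ∀ p,
      w • ((normalEquiv k n).trans (EndGraph.of f)) p = EndGraph.of f (a * normal k n p) :=
    fun h p => (doubleModule_smul_of_symm_eq k n h _).trans (by rw [one_smul]; rfl)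
  have hr : ∀ {w : WeylAlgebra k (n + n)} {b : WeylAlgebra k n},
      (envelopingEquiv k n).symm w = 1 ⊗ₜ MulOpposite.op b → ∀ p,
      w • ((normalEquiv k n).trans (EndGraph.of f)) p = EndGraph.of f (normal k n p * f b) :=
    fun h p => (doubleModule_smul_of_symm_eq k n h _).trans (by rw [one_smul]; rfl)
  refine ⟨fun i p => ?_, fun i p => ?_, fun s => ?_⟩
  · cases i using Fin.addCases with
    | left i =>
      rw [hl (envelopingEquiv_symm_x_castAdd i)]
      obtain ⟨q, hq, e⟩ := exists_mul_normal_eq (bernsteinSpan_mono hd (x_mem_bernsteinSpan i)) p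
      exact ⟨q, hq, congrArg _ e⟩
    | right i =>
      rw [hr (envelopingEquiv_symm_x_natAdd i)]
      obtain ⟨q, hq, e⟩ := exists_normal_mul_eq (hx i) p
      exact ⟨q, hq, congrArg _ e⟩
  · cases i using Fin.addCases with
    | left i =>
      rw [hl (envelopingEquiv_symm_d_castAdd i)]
      obtain ⟨q, hq, e⟩ := exists_mul_normal_eq (bernsteinSpan_mono hd (d_mem_bernsteinSpan i)) p
      exact ⟨q, hq, congrArg _ e⟩
    | right i =>
      rw [hr (envelopingEquiv_symm_d_natAdd i), map_neg]
      obtain ⟨q, hq, e⟩ := exists_normal_mul_eq (neg_mem (hd' i)) p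
      exact ⟨q, hq, congrArg _ e⟩
  · cases s with
    | inl i =>
      refine ⟨x k (Fin.castAdd n i), fun p => ⟨0, by simp, ?_⟩⟩
      rw [hl (envelopingEquiv_symm_x_castAdd i), add_zero, ← normal_X_inl_mul]
      rfl
    | inr i =>
      refine ⟨WeylAlgebra.d k (Fin.castAdd n i), fun p =>
        ⟨pderiv (Sum.inl i) p, totalDegree_pderiv_le_self _ _, ?_⟩⟩
      rw [hl (envelopingEquiv_symm_d_castAdd i), d_mul_normal]
      rfl

/-- On the dual graph, right multiplication plays the role of left multiplication on the graph. -/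
theorem isPolynomialChart_endDualGraph (f : WeylAlgebra k n →ₐ[k] WeylAlgebra k n) {d : ℕ}
    (hd : 1 ≤ d) (hx : ∀ i, f (x k i) ∈ bernsteinSpan k n d)
    (hd' : ∀ i, f (WeylAlgebra.d k i) ∈ bernsteinSpan k n d) :
    letI := doubleModule k n (EndDualGraph f)
    IsPolynomialChart k (n + n) ((normalEquiv k n).trans (EndDualGraph.of f)) d := by
  let := doubleModule k n (EndDualGraph f)
  have hl : ∀ {w : WeylAlgebra k (n + n)} {a : WeylAlgebra k n},
      (envelopingEquiv k n).symm w = a ⊗ₜ 1 → ∀ p,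
      w • ((normalEquiv k n).trans (EndDualGraph.of f)) p
        = EndDualGraph.of f (f a * normal k n p) :=
    fun h p => (doubleModule_smul_of_symm_eq k n h _).trans (by rw [one_smul]; rfl)
  have hr : ∀ {w : WeylAlgebra k (n + n)} {b : WeylAlgebra k n},
      (envelopingEquiv k n).symm w = 1 ⊗ₜ MulOpposite.op b → ∀ p,
      w • ((normalEquiv k n).trans (EndDualGraph.of f)) p
        = EndDualGraph.of f (normal k n p * b) :=
    fun h p => (doubleModule_smul_of_symm_eq k n h _).trans (by rw [one_smul]; rfl)
  refine ⟨fun i p => ?_, fun i p => ?_, fun s => ?_⟩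
  · cases i using Fin.addCases with
    | left i =>
      rw [hl (envelopingEquiv_symm_x_castAdd i)]
      obtain ⟨q, hq, e⟩ := exists_mul_normal_eq (hx i) p
      exact ⟨q, hq, congrArg _ e⟩
    | right i =>
      rw [hr (envelopingEquiv_symm_x_natAdd i)]
      obtain ⟨q, hq, e⟩ := exists_normal_mul_eq (bernsteinSpan_mono hd (x_mem_bernsteinSpan i)) p
      exact ⟨q, hq, congrArg _ e⟩
  · cases i using Fin.addCases with
    | left i =>
      rw [hl (envelopingEquiv_symm_d_castAdd i)]
      obtain ⟨q, hq, e⟩ := exists_mul_normal_eq (hd' i) p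
      exact ⟨q, hq, congrArg _ e⟩
    | right i =>
      rw [hr (envelopingEquiv_symm_d_natAdd i)]
      obtain ⟨q, hq, e⟩ :=
        exists_normal_mul_eq (neg_mem (bernsteinSpan_mono hd (d_mem_bernsteinSpan i))) p
      exact ⟨q, hq, congrArg _ e⟩
  · cases s with
    | inl i =>
      refine ⟨x k (Fin.natAdd n i), fun p =>
        ⟨pderiv (Sum.inr i) p, totalDegree_pderiv_le_self _ _, ?_⟩⟩
      rw [hr (envelopingEquiv_symm_x_natAdd i), normal_mul_x]
      rfl
    | inr i =>
      -- The generator `∂_{n+i}` acts as right multiplication by `-∂_i`.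
      refine ⟨-WeylAlgebra.d k (Fin.natAdd n i), fun p => ⟨0, by simp, ?_⟩⟩
      rw [neg_smul, hr (envelopingEquiv_symm_d_natAdd i), mul_neg, map_neg, neg_neg, add_zero,
        ← normal_X_inr_mul]
      rfl

end WeylAlgebra

theorem mainTheorem1 (k : Type*) [Field k] [CharZero k] (n : ℕ)
    (f : WeylAlgebra k n →ₐ[k] WeylAlgebra k n) :
    (IsHolonomicBimodule k n (EndGraph f) ∧ IsHolonomicBimodule k n (EndDualGraph f)) ∧
      (IsSimpleBimodule k (WeylAlgebra k n) (EndGraph f) ∧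
        IsSimpleBimodule k (WeylAlgebra k n) (EndDualGraph f)) := by
  obtain ⟨d, hd, hx, hd'⟩ := WeylAlgebra.exists_degree_bound f
  have h1 := WeylAlgebra.isHolonomicBimodule_and_isSimpleBimodule k n (EndGraph f) _
    (WeylAlgebra.isPolynomialChart_endGraph f hd hx hd')
  have h2 := WeylAlgebra.isHolonomicBimodule_and_isSimpleBimodule k n (EndDualGraph f) _
    (WeylAlgebra.isPolynomialChart_endDualGraph f hd hx hd')
  exact ⟨⟨h1.1, h2.1⟩, h1.2, h2.2⟩
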